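/- Let $R$ be a commutative artin ring and let $\mathcal{C}$ be a dualizing $R$-variety, i.e. a small additive $R$-category with split idempotents and finitely generated $R$-modules $\mathcal{C}(X,Y)$, such that $M\mapsto \mathrm{Hom}_R(M(-),E)$, with $E$ the injective envelope of $R/\mathrm{rad}(R)$, restricts to a duality between $\mathrm{mod}(\mathcal{C})$ and $\mathrm{mod}(\mathcal{C}^{op})$. Here $\mathrm{Mod}(\mathcal{A})$ denotes the category of additive functors from $\mathcal{A}$ to abelian groups, and $\mathrm{mod}(\mathcal{A})$ its full subcategory of functors $M$ having an exact sequence $\mathrm{Hom}_{\mathcal{A}}(A_0,-)\to \mathrm{Hom}_{\mathcal{A}}(A_1,-)\to M\to 0$. Let $C\in\mathcal{C}$, let $P=\mathrm{Hom}_{\mathcal{C}}(C,-)$, and let $\mathcal{I}=\mathrm{Tr}_P\mathcal{C}$ be the ideal of $\mathcal{C}$ with $\mathcal{I}(X,Y)=\sum_{f:P\to \mathrm{Hom}_{\mathcal{C}}(X,-)}\mathrm{Im}(f_Y)$. Let $\pi:\mathcal{C}\to\mathcal{C}/\mathcal{I}$ be the canonical functor to the quotient category and $\pi_*:\mathrm{Mod}(\mathcal{C}/\mathcal{I})\to\mathrm{Mod}(\mathcal{C})$,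 $F\mapsto F\circ\pi$. Suppose that $\mathcal{I}(C',-)$ is a projective $\mathcal{C}$-module for all $C'\in\mathcal{C}$. Then: 1. $\mathcal{I}$ is strongly idempotent: the canonical maps $\mathrm{Ext}^i_{\mathrm{Mod}(\mathcal{C}/\mathcal{I})}(F,F')\to \mathrm{Ext}^i_{\mathrm{Mod}(\mathcal{C})}(\pi_*F,\pi_*F')$ induced by $\pi_*$ are isomorphisms for all $F,F'\in\mathrm{Mod}(\mathcal{C}/\mathcal{I})$ and all $i\ge 0$. 2. $\mathrm{mod}(\mathcal{C})$ and $\mathrm{mod}(\mathcal{C}/\mathcal{I})$ are abelian subcategories of $\mathrm{Mod}(\mathcal{C})$ and $\mathrm{Mod}(\mathcal{C}/\mathcal{I})$ (closed under finite direct sums, kernels and cokernels), $\pi_*$ restricts to an exact functor $\pi_*:\mathrm{mod}(\mathcal{C}/\mathcal{I})\to\mathrm{mod}(\mathcal{C})$, the induced maps $\mathrm{Ext}^i_{\mathrm{mod}(\mathcal{C}/\mathcal{I})}(F,F')\to \mathrm{Ext}^i_{\mathrm{mod}(\mathcal{C})}(\pi_*F,\pi_*F')$ are isomorphisms for all $F,F'\in\mathrm{mod}(\mathcal{C}/\mathcal{I})$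 and $i\ge 0$, and the induced functor $$D^b(\pi_*):D^b(\mathrm{mod}(\mathcal{C}/\mathcal{I}))\to D^b(\mathrm{mod}(\mathcal{C}))$$ between bounded derived categories is a full embedding, i.e. fully faithful. -/

import Mathlib

open CategoryTheory CategoryTheory.Limits Opposite

universe u

noncomputable section

/-! ### Abelian subcategories and restrictions of exact functors -/

namespace CategoryTheory.ObjectProperty

/-- The full subcategory of objects satisfying `P` is an abelian subcategory of `A`: it contains
a zero object and is closed under finite products, kernels and cokernels formed in `A`.
Mathlib then provides `Abelian P.FullSubcategory`, and the inclusion is exact. -/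
class IsAbelianSubcategory {A : Type*} [Category* A] [Abelian A] (P : ObjectProperty A) : Prop
    extends P.ContainsZero, P.IsClosedUnderKernels, P.IsClosedUnderCokernels,
      P.IsClosedUnderFiniteProducts

section

variable {A : Type*} [Category* A] [Abelian A] {B : Type*} [Category* B] [Abelian B]
  (P : ObjectProperty A) (Q : ObjectProperty B)

/-- The functor between full subcategories induced by a functor `G` sending `P` into `Q`. -/
abbrev restrictFunctor (G : A ⥤ B) (h : ∀ X, P X → Q (G.obj X)) :
    P.FullSubcategory ⥤ Q.FullSubcategory :=
  Q.lift (P.ι ⋙ G) (fun X => h X.obj X.property)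

instance preservesFiniteLimits_ι_of_isAbelianSubcategory [P.IsAbelianSubcategory] :
    PreservesFiniteLimits P.ι :=
  haveI : ∀ {X Y : P.FullSubcategory} (f : X ⟶ Y), PreservesLimit (parallelPair f 0) P.ι :=
    fun f => P.preservesKernels_ι f
  Functor.preservesFiniteLimits_of_preservesKernels P.ι

instance preservesFiniteColimits_ι_of_isAbelianSubcategory [P.IsAbelianSubcategory] :
    PreservesFiniteColimits P.ι :=
  haveI : ∀ {X Y : P.FullSubcategory} (f : X ⟶ Y), PreservesColimit (parallelPair f 0) P.ι :=
    fun f => P.preservesCokernels_ι f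
  Functor.preservesFiniteColimits_of_preservesCokernels P.ι

instance preservesFiniteLimits_restrictFunctor [P.IsAbelianSubcategory] [Q.IsAbelianSubcategory]
    (G : A ⥤ B) [PreservesFiniteLimits G] (h : ∀ X, P X → Q (G.obj X)) :
    PreservesFiniteLimits (restrictFunctor P Q G h) :=
  haveI : PreservesFiniteLimits (restrictFunctor P Q G h ⋙ Q.ι) :=
    inferInstanceAs (PreservesFiniteLimits (P.ι ⋙ G))
  preservesFiniteLimits_of_reflects_of_preserves _ Q.ι

instance preservesFiniteColimits_restrictFunctor [P.IsAbelianSubcategory]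
    [Q.IsAbelianSubcategory]
    (G : A ⥤ B) [PreservesFiniteColimits G] (h : ∀ X, P X → Q (G.obj X)) :
    PreservesFiniteColimits (restrictFunctor P Q G h) :=
  haveI : PreservesFiniteColimits (restrictFunctor P Q G h ⋙ Q.ι) :=
    inferInstanceAs (PreservesFiniteColimits (P.ι ⋙ G))
  preservesFiniteColimits_of_reflects_of_preserves _ Q.ι

end

end CategoryTheory.ObjectProperty

/-! ### Maps on Ext groups and on bounded derived categories induced by an exact functor -/

section

variable {A : Type*} [Category* A] [Abelian A] {B : Type*} [Category* B] [Abelian B]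
  (G : A ⥤ B) [G.Additive] [PreservesFiniteLimits G] [PreservesFiniteColimits G]

/-- The canonical maps `Ext^i_A(X, Y) ⟶ Ext^i_B(G X, G Y)` induced by the exact functor `G` are
isomorphisms for all `X`, `Y` and all `i ≥ 0`. -/
def CategoryTheory.Functor.InducesExtIsos : Prop :=
  haveI := HasExt.standard A
  haveI := HasExt.standard B
  ∀ (X Y : A) (i : ℕ), Function.Bijective (G.mapExtAddHom X Y i)

attribute [local instance] HasDerivedCategory.standard

lemma CategoryTheory.Functor.bounded_mapDerivedCategory_obj (X : DerivedCategory A)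
    (hX : (DerivedCategory.TStructure.t (C := A)).bounded X) :
    (DerivedCategory.TStructure.t (C := B)).bounded (G.mapDerivedCategory.obj X) := by
  obtain ⟨⟨a, ha⟩, ⟨b, hb⟩⟩ := hX
  refine ⟨⟨a, ?_⟩, ⟨b, ?_⟩⟩
  · obtain ⟨K, e, hK⟩ := ha
    refine ⟨_, G.mapDerivedCategory.mapIso e ≪≫ G.mapDerivedCategoryFactors.app K, ?_⟩
    exact inferInstanceAs
      (CochainComplex.IsStrictlyGE ((G.mapHomologicalComplex (.up ℤ)).obj K) a)
  · obtain ⟨K, e, hK⟩ := hb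
    refine ⟨_, G.mapDerivedCategory.mapIso e ≪≫ G.mapDerivedCategoryFactors.app K, ?_⟩
    exact inferInstanceAs
      (CochainComplex.IsStrictlyLE ((G.mapHomologicalComplex (.up ℤ)).obj K) b)

/-- The functor `D^b(G) : D^b(A) ⥤ D^b(B)` induced by an exact functor `G : A ⥤ B`; the bounded
derived category is the full subcategory of the derived category on the complexes with bounded
cohomology. -/
def CategoryTheory.Functor.mapBoundedDerivedCategory :
    DerivedCategory.Bounded A ⥤ DerivedCategory.Bounded B :=
  ObjectProperty.restrictFunctor _ _ G.mapDerivedCategory G.bounded_mapDerivedCategory_obj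

end

/-! ### Modules over a small preadditive category -/

/-- `Mod(C)`: the category of additive covariant functors from `C` to abelian groups. -/
abbrev ModCat (C : Type u) [SmallCategory C] [Preadditive C] := C ⥤+ AddCommGrpCat.{u}

namespace ModCat

lemma additive_of_mono {C : Type u} [SmallCategory C] [Preadditive C]
    {F G : C ⥤ AddCommGrpCat.{u}} [G.Additive] (i : F ⟶ G) [Mono i] : F.Additive where
  map_add {X Y f g} := by
    rw [← cancel_mono (i.app Y)]
    simp [Preadditive.add_comp, Preadditive.comp_add]

lemma additive_of_epi {C : Type u} [SmallCategory C] [Preadditive C]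
    {F G : C ⥤ AddCommGrpCat.{u}} [F.Additive] (p : F ⟶ G) [Epi p] : G.Additive where
  map_add {X Y f g} := by
    rw [← cancel_epi (p.app X)]
    simp only [← p.naturality, Functor.map_add, Preadditive.add_comp, Preadditive.comp_add]

/-- Kernels, cokernels and finite products of additive functors are additive, so that `Mod(C)` is
an abelian category. -/
instance additiveFunctor_isAbelianSubcategory (C : Type u) [SmallCategory C] [Preadditive C] :
    (additiveFunctor C AddCommGrpCat.{u}).IsAbelianSubcategory where
  exists_zero := by
    obtain ⟨Z, hZ⟩ := HasZeroObject.zero (C := C ⥤ AddCommGrpCat.{u})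
    exact ⟨Z, hZ, ⟨fun {X Y f g} => ((Functor.isZero_iff _).1 hZ Y).eq_of_tgt _ _⟩⟩
  kernels_le := by
    rintro _ ⟨f, k, hk, hf⟩
    have : Functor.Additive _ := hf.1
    have : Mono k.ι := Fork.IsLimit.mono hk
    exact additive_of_mono k.ι
  cokernels_le := by
    rintro _ ⟨f, k, hk, hf⟩
    have : Functor.Additive _ := hf.2
    have : Epi k.π := Cofork.IsColimit.epi hk
    exact additive_of_epi k.π
  isClosedUnderLimitsOfShape J _ := ⟨by
    rintro F ⟨p⟩
    refine ⟨fun {X Y f g} => ?_⟩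
    refine (isLimitOfPreserves ((evaluation C AddCommGrpCat.{u}).obj Y) p.isLimit).hom_ext
      fun j => ?_
    have : (p.diag.obj j).Additive := p.prop_diag_obj j
    have h : ∀ a : X ⟶ Y, F.map a ≫ (p.π.app j).app Y =
        (p.π.app j).app X ≫ (p.diag.obj j).map a := fun a => (p.π.app j).naturality a
    change F.map (f + g) ≫ (p.π.app j).app Y = (F.map f + F.map g) ≫ (p.π.app j).app Y
    rw [Preadditive.add_comp, h, h, h, Functor.map_add, Preadditive.comp_add]⟩

variable {C : Type u} [SmallCategory C] [Preadditive C]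

/-- The representable module `Hom_C(X, -)`. -/
def rep (X : C) : ModCat C := AdditiveFunctor.of (preadditiveCoyoneda.obj (op X))

/-- `M` is finitely presented: there is an exact sequence
`Hom_C(X₀, -) ⟶ Hom_C(X₁, -) ⟶ M ⟶ 0` in `Mod(C)`. -/
def IsFinPres (C : Type u) [SmallCategory C] [Preadditive C] : ObjectProperty (ModCat C) :=
  fun M => ∃ (X₀ X₁ : C) (f : rep X₀ ⟶ rep X₁) (g : rep X₁ ⟶ M) (w : f ≫ g = 0),
    (ShortComplex.mk f g w).Exact ∧ Epi g

/-- `Tr_P(N)(Y)`: the sum of the subgroups `Im (f_Y)`, where `f` runs over all morphisms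
`P ⟶ N`. -/
def trace (P N : ModCat C) (Y : C) : AddSubgroup (N.obj.obj Y) :=
  ⨆ f : P ⟶ N, (f.hom.app Y).hom.range

end ModCat

/-- `mod(C)`: the full subcategory of `Mod(C)` of finitely presented modules. -/
abbrev FinPresMod (C : Type u) [SmallCategory C] [Preadditive C] :=
  (ModCat.IsFinPres C).FullSubcategory

/-! ### Ideals and quotient categories -/

/-- A (two-sided) ideal of a preadditive category. -/
structure CatIdeal (C : Type u) [SmallCategory C] [Preadditive C] where
  /-- The subgroup `I(X, Y)` of `Hom_C(X, Y)`. -/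
  hom (X Y : C) : AddSubgroup (X ⟶ Y)
  comp_mem_left {X Y Z : C} (g : X ⟶ Y) {f : Y ⟶ Z} : f ∈ hom Y Z → g ≫ f ∈ hom X Z
  comp_mem_right {X Y Z : C} {f : X ⟶ Y} (h : Y ⟶ Z) : f ∈ hom X Y → f ≫ h ∈ hom X Z

namespace CatIdeal

variable {C : Type u} [SmallCategory C] [Preadditive C] (I : CatIdeal C)

/-- The congruence `f - g ∈ I(X, Y)`. -/
def rel : HomRel C := fun X Y f g => f - g ∈ I.hom X Y

instance : Congruence I.rel where
  comp_left f g g' h := by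
    simpa [rel, Preadditive.comp_sub] using I.comp_mem_left f h
  comp_right g h := by
    simpa [rel, Preadditive.sub_comp] using I.comp_mem_right g h
  equivalence :=
    { refl := fun f => by simp [rel]
      symm := fun {f g} h => by simpa [rel] using neg_mem h
      trans := fun {f g k} h h' => by simpa [rel] using add_mem h h' }

/-- The quotient category `C/I`. -/
abbrev Quot : Type u := Quotient I.rel

lemma rel_add ⦃X Y : C⦄ (f₁ f₂ g₁ g₂ : X ⟶ Y) (hf : I.rel f₁ f₂) (hg : I.rel g₁ g₂) :
    I.rel (f₁ + g₁) (f₂ + g₂) := by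
  have : f₁ + g₁ - (f₂ + g₂) = (f₁ - f₂) + (g₁ - g₂) := by abel
  simpa only [rel, this] using add_mem hf hg

instance : Preadditive I.Quot := Quotient.preadditive I.rel I.rel_add

/-- The canonical functor `π : C ⥤ C/I`. -/
abbrev proj : C ⥤ I.Quot := Quotient.functor I.rel

instance : I.proj.Additive := Quotient.functor_additive I.rel I.rel_add

/-- The functor `π_* : Mod(C/I) ⥤ Mod(C)`, `F ↦ F ∘ π`. -/
abbrev pushforward : ModCat I.Quot ⥤ ModCat C :=
  ObjectProperty.restrictFunctor _ _
    ((Functor.whiskeringLeft C I.Quot AddCommGrpCat.{u}).obj I.proj)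
    (fun F (_ : F.Additive) => inferInstanceAs (I.proj ⋙ F).Additive)

instance : PreservesFiniteLimits I.pushforward :=
  ObjectProperty.preservesFiniteLimits_restrictFunctor _ _ _ _

instance : PreservesFiniteColimits I.pushforward :=
  ObjectProperty.preservesFiniteColimits_restrictFunctor _ _ _ _

/-- The restriction `π_* : mod(C/I) ⥤ mod(C)`, defined as soon as `π_*` sends finitely presented
modules to finitely presented modules. -/
abbrev pushforwardFinPres
    (h : ∀ F, ModCat.IsFinPres I.Quot F → ModCat.IsFinPres C (I.pushforward.obj F)) :
    FinPresMod I.Quot ⥤ FinPresMod C :=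
  ObjectProperty.restrictFunctor _ _ I.pushforward h

/-- `I` is strongly idempotent: the canonical maps
`Ext^i_{Mod(C/I)}(F, F') ⟶ Ext^i_{Mod(C)}(π_* F, π_* F')` are isomorphisms for all
`C/I`-modules `F`, `F'` and all `i ≥ 0`. -/
def IsStronglyIdempotent : Prop := I.pushforward.InducesExtIsos

/-- The module `I(X, -)`, a submodule of `Hom_C(X, -)`. -/
def leftModule (X : C) : ModCat C :=
  ⟨{ obj := fun Y => AddCommGrpCat.of (I.hom X Y)
     map := fun {Y Z} h => AddCommGrpCat.ofHom
       { toFun := fun f => ⟨f.1 ≫ h, I.comp_mem_right h f.2⟩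
         map_zero' := by simp
         map_add' := by simp } },
   ⟨by intros; ext; simp [Preadditive.comp_add]⟩⟩

/-- The trace ideal `Tr_P C`, given by `(Tr_P C)(X, Y) = Tr_P(Hom_C(X, -))(Y)`. -/
def traceIdeal (P : ModCat C) : CatIdeal C where
  hom X Y := ModCat.trace P (ModCat.rep X) Y
  comp_mem_left {X Y Z} g f hf := by
    let φ : ModCat.rep Y ⟶ ModCat.rep X :=
      ObjectProperty.homMk (preadditiveCoyoneda.map g.op)
    have h : ModCat.trace P (ModCat.rep Y) Z ≤
        (ModCat.trace P (ModCat.rep X) Z).comap (φ.hom.app Z).hom :=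
      iSup_le fun a => by
        rintro _ ⟨x, rfl⟩
        exact le_iSup (fun b : P ⟶ ModCat.rep X => (b.hom.app Z).hom.range) (a ≫ φ) ⟨x, rfl⟩
    exact h hf
  comp_mem_right {X Y Z} f g hf := by
    have h : ModCat.trace P (ModCat.rep X) Y ≤
        (ModCat.trace P (ModCat.rep X) Z).comap ((ModCat.rep X).obj.map g).hom :=
      iSup_le fun a => by
        rintro _ ⟨x, rfl⟩
        exact le_iSup (fun b : P ⟶ ModCat.rep X => (b.hom.app Z).hom.range) a
          ⟨(P.obj.map g).hom x, ConcreteCategory.congr_hom (a.hom.naturality g) x⟩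
    exact h hf

end CatIdeal

/-! ### Dualizing varieties -/

section

variable (R : Type u) [CommRing R] {C : Type u} [SmallCategory C] [Preadditive C] [Linear R C]

/-- The group `M(X)`, regarded as an `R`-module through `R ⟶ End_C(X)`. -/
def RObj (_ : Type u) {C : Type u} [SmallCategory C] [Preadditive C] (M : ModCat C) (X : C) :
    Type u :=
  M.obj.obj X

instance (M : ModCat C) (X : C) : AddCommGroup (RObj R M X) :=
  inferInstanceAs (AddCommGroup (M.obj.obj X))

instance (M : ModCat C) (X : C) : Module R (RObj R M X) where
  smul r x := (M.obj.map (r • 𝟙 X)).hom x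
  one_smul x := by
    have h : M.obj.map ((1 : R) • 𝟙 X) = 𝟙 _ := by rw [one_smul, M.obj.map_id]
    exact ConcreteCategory.congr_hom h x
  mul_smul r s x := by
    have h : M.obj.map ((r * s) • 𝟙 X) = M.obj.map (s • 𝟙 X) ≫ M.obj.map (r • 𝟙 X) := by
      rw [← M.obj.map_comp, Linear.comp_smul, Category.comp_id, mul_smul]
    exact ConcreteCategory.congr_hom h x
  smul_zero r := map_zero (M.obj.map (r • 𝟙 X)).hom
  smul_add r x y := map_add (M.obj.map (r • 𝟙 X)).hom x y
  add_smul r s x := by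
    change (M.obj.map ((r + s) • 𝟙 X)).hom x =
      (M.obj.map (r • 𝟙 X)).hom x + (M.obj.map (s • 𝟙 X)).hom x
    rw [add_smul, M.obj.map_add]
    rfl
  zero_smul x := by
    change (M.obj.map ((0 : R) • 𝟙 X)).hom x = 0
    rw [zero_smul, M.obj.map_zero]
    rfl

/-- The `R`-linear map `M(X) ⟶ M(Y)` induced by `f : X ⟶ Y`. -/
def RObj.map (M : ModCat C) {X Y : C} (f : X ⟶ Y) : RObj R M X →ₗ[R] RObj R M Y where
  toFun := (M.obj.map f).hom
  map_add' := (M.obj.map f).hom.map_add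
  map_smul' r x := by
    have h : M.obj.map (r • 𝟙 X) ≫ M.obj.map f = M.obj.map f ≫ M.obj.map (r • 𝟙 Y) := by
      rw [← M.obj.map_comp, ← M.obj.map_comp, Linear.comp_smul, Linear.smul_comp,
        Category.comp_id, Category.id_comp]
    exact ConcreteCategory.congr_hom h x

/-- The `R`-linear map `M(X) ⟶ N(X)` induced by a morphism of modules. -/
def RObj.app {M N : ModCat C} (φ : M ⟶ N) (X : C) : RObj R M X →ₗ[R] RObj R N X where
  toFun := (φ.hom.app X).hom
  map_add' := (φ.hom.app X).hom.map_add
  map_smul' r x := ConcreteCategory.congr_hom (φ.hom.naturality (r • 𝟙 X)) x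

variable (C) (E : Type u) [AddCommGroup E] [Module R E]

/-- The contravariant functor `M ↦ (X ↦ Hom_R(M(X), E))` from `Mod(C)` to `Mod(Cᵒᵖ)`. -/
def dualFunctor : (ModCat C)ᵒᵖ ⥤ ModCat Cᵒᵖ where
  obj M := ⟨
    { obj := fun X => AddCommGrpCat.of (RObj R M.unop X.unop →ₗ[R] E)
      map := fun f => AddCommGrpCat.ofHom
        (LinearMap.lcomp R E (RObj.map R M.unop f.unop)).toAddMonoidHom
      map_id := fun X => by
        refine AddCommGrpCat.ext fun (g : RObj R M.unop X.unop →ₗ[R] E) => ?_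
        refine LinearMap.ext (R := R) (M₃ := E) fun x => ?_
        exact congrArg g (ConcreteCategory.congr_hom (M.unop.obj.map_id X.unop) x)
      map_comp := fun {X Y Z} a b => by
        refine AddCommGrpCat.ext fun (g : RObj R M.unop X.unop →ₗ[R] E) => ?_
        refine LinearMap.ext (R := R) (M₃ := E) fun x => ?_
        exact congrArg g (ConcreteCategory.congr_hom (M.unop.obj.map_comp b.unop a.unop) x) },
    ⟨fun {X Y a b} => by
        refine AddCommGrpCat.ext fun (g : RObj R M.unop X.unop →ₗ[R] E) => ?_
        refine LinearMap.ext (R := R) (M₃ := E) fun x => ?_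
        exact (congrArg g (ConcreteCategory.congr_hom
          (M.unop.obj.map_add (f := a.unop) (g := b.unop)) x)).trans (map_add g _ _)⟩⟩
  map {M N} φ := ObjectProperty.homMk
    { app := fun X => AddCommGrpCat.ofHom
        (LinearMap.lcomp R E (RObj.app R φ.unop X.unop)).toAddMonoidHom
      naturality := fun X Y a => by
        refine AddCommGrpCat.ext fun (g : RObj R M.unop X.unop →ₗ[R] E) => ?_
        refine LinearMap.ext (R := R) (M₃ := E) fun x => ?_
        exact congrArg g (ConcreteCategory.congr_hom (φ.unop.hom.naturality a.unop) x).symm }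

/-- The functor `mod(C)ᵒᵖ ⥤ mod(Cᵒᵖ)` obtained by restricting `M ↦ Hom_R(M(-), E)`. -/
abbrev dualFunctorFinPres
    (h : ∀ M, ModCat.IsFinPres C M → ModCat.IsFinPres Cᵒᵖ ((dualFunctor R C E).obj (op M))) :
    (FinPresMod C)ᵒᵖ ⥤ FinPresMod Cᵒᵖ :=
  (ModCat.IsFinPres Cᵒᵖ).lift ((ModCat.IsFinPres C).ι.op ⋙ dualFunctor R C E)
    (fun M => h M.unop.obj M.unop.property)

end

/-- `ι : S ⟶ E` is an injective envelope of the `R`-module `S`: `E` is injective, and `ι` is a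
monomorphism whose image is an essential submodule of `E`. -/
structure IsInjectiveEnvelope {R : Type u} [CommRing R] {S E : Type u} [AddCommGroup S]
    [Module R S] [AddCommGroup E] [Module R E] (ι : S →ₗ[R] E) : Prop where
  injective_module : Module.Injective R E
  injective : Function.Injective ι
  essential : ∀ N : Submodule R E, N ⊓ LinearMap.range ι = ⊥ → N = ⊥

/-- `C` is a dualizing `R`-variety: `R` is a commutative artin ring, `C` is a small additive
`R`-category with split idempotents, its Hom-modules are finitely generated, and
`M ↦ Hom_R(M(-), E)`, where `E` is the injective envelope of `R/rad(R)`, restricts to a duality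
between `mod(C)` and `mod(Cᵒᵖ)`. -/
structure IsDualizingVariety (R : Type u) [CommRing R] (C : Type u) [SmallCategory C]
    [Preadditive C] [Linear R C] : Prop where
  artinian : IsArtinianRing R
  additive : HasFiniteBiproducts C
  idempotents_split : IsIdempotentComplete C
  hom_finite : ∀ X Y : C, Module.Finite R (X ⟶ Y)
  dualizing : ∃ (E : Type u) (_ : AddCommGroup E) (_ : Module R E)
    (ι : (R ⧸ Ring.jacobson R) →ₗ[R] E)
    (h : ∀ M, ModCat.IsFinPres C M → ModCat.IsFinPres Cᵒᵖ ((dualFunctor R C E).obj (op M))),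
    IsInjectiveEnvelope ι ∧ (dualFunctorFinPres R C E h).IsEquivalence

end

/-! ### Maps on Ext groups induced by an exact functor -/

namespace CategoryTheory

open Abelian

section

universe w w' v v' u' u''

variable {A : Type u'} [Category.{v} A] [Abelian A] {B : Type u''} [Category.{v'} B] [Abelian B]

/-! The ideal consists of the sums of morphisms factoring through `X`, the object defining the
trace. Since `𝟙 X` is such a morphism, every module over the quotient vanishes at `X`, and therefore
there is no nonzero morphism from `I(X', -)` to any `π_* F` (`leftModule_traceIdeal_hom_eq_zero`).
As `I(X', -)` is projective, `0 → I(X', -) → Hom(X', -) → π_* Hom(π X', -) → 0` is a projective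
resolution of length one, so `π_* Hom(π X', -)` has no higher Ext into any `π_* F`. The functor
`π_*` is exact and fully faithful, and dimension shifting along covers by representables gives the
Ext isomorphisms (`mapExt_bijective_of_acyclic`).

The same argument runs inside `mod` once the resolution lives there. The duality turns cokernels in
`mod(Cᵒᵖ)` into kernels in `mod(C)`, and finite generation of `Hom(X', X)` makes each `I(X', -)`
generated by one element, so that `π_*` preserves finite presentation. Full faithfulness on `D^b`
then follows by dévissage: Ext isomorphisms treat objects placed in a single degree, and truncation
triangles with a five lemma argument do the rest (`bounded_induction`, `shiftHomBijective`). -/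

lemma Abelian.Ext.subsingleton_of_shortExact_projective [HasExt.{w} A] {S : ShortComplex A}
    (hS : S.ShortExact) [Projective S.X₁] [Projective S.X₂] (Y : A)
    (hY : ∀ f : S.X₁ ⟶ Y, f = 0) (n : ℕ) : Subsingleton (Ext.{w} S.X₃ Y (n + 1)) := by
  refine subsingleton_of_forall_eq 0 fun e => ?_
  -- Projectivity of `S.X₂` makes every class come from `Ext^n(S.X₁, Y)`. Projectivity of `S.X₁`
  -- kills this group for `n > 0`; `hY` is needed only for `n = 0`.
  obtain ⟨x, rfl⟩ := Ext.contravariant_sequence_exact₃ hS Y e (Ext.eq_zero_of_projective _)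
    (add_comm 1 n)
  suffices x = 0 by simp [this]
  cases n with
  | zero =>
    obtain ⟨f, rfl⟩ := (Ext.mk₀_bijective _ _).2 x
    simp [hY f]
  | succ n => exact Ext.eq_zero_of_projective x

variable (F : A ⥤ B) [F.Additive] [PreservesFiniteLimits F] [PreservesFiniteColimits F]

attribute [local simp] Ext.mapExactFunctor_comp Ext.mapExactFunctor_mk₀ Ext.mapExactFunctor_extClass

attribute [local instance] Ext.subsingleton_of_projective in
/-- A fully faithful exact functor induces isomorphisms on Ext groups as soon as every object is a
quotient of a projective object whose image is acyclic for all `Hom(-, F.obj Y)`. -/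
lemma Functor.mapExt_bijective_of_acyclic [F.Full] [F.Faithful] [HasExt.{w} A] [HasExt.{w'} B]
    (h : ∀ X : A, ∃ (P : A) (p : P ⟶ X), Epi p ∧ Projective P ∧
      ∀ (Y : A) (n : ℕ), Subsingleton (Ext.{w'} (F.obj P) (F.obj Y) (n + 1)))
    (X Y : A) (n : ℕ) : Function.Bijective (F.mapExtAddHom (X := X) (Y := Y) (n := n)) := by
  induction n generalizing X with
  | zero => simpa [Ext.mapExactFunctor₀] using ⟨Faithful.map_injective, Full.map_surjective⟩
  | succ n hn =>
    obtain ⟨P, p, _, _, hP⟩ := h X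
    let S := ShortComplex.mk _ _ (kernel.condition p)
    have hS : S.ShortExact := { exact := ShortComplex.exact_kernel p }
    have := hP Y n
    -- Both rows end in a surjective connecting map onto `Ext^{n+1}`: the upper one by projectivity
    -- of `P`, the lower one by acyclicity of `F.obj P`.
    exact AddMonoidHom.bijective_of_surjective_of_bijective_of_right_exact _ _ _ _
      (F.mapExtAddHom S.X₂ Y n) (F.mapExtAddHom S.X₁ Y n) (F.mapExtAddHom S.X₃ Y (n + 1))
      (by cat_disch) (by cat_disch)
      ((ShortComplex.ab_exact_iff_function_exact _).1
        (Ext.contravariant_sequence_exact₁' hS Y n (n + 1) (add_comm 1 n)))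
      ((ShortComplex.ab_exact_iff_function_exact _).1
        (Ext.contravariant_sequence_exact₁' (hS.map F) (F.obj Y) n (n + 1) (add_comm 1 n)))
      (hn _).surjective (hn _)
      (fun x₃ ↦ Ext.contravariant_sequence_exact₃ hS _ x₃ (Subsingleton.elim _ _) (add_comm 1 n))
      (fun y₃ ↦ Ext.contravariant_sequence_exact₃ (hS.map F) _ y₃
        (Subsingleton.elim (α := Ext (F.obj P) (F.obj Y) (n + 1)) _ _) (add_comm 1 n))

end

/-! ### Dévissage for triangulated functors -/

namespace Functor

section

variable {A : Type*} [Category* A] {B : Type*} [Category* B] {F : A ⥤ B}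

lemma map_bijective_of_iso {X X' Y Y' : A} (e : X ≅ X') (e' : Y ≅ Y')
    (h : Function.Bijective (fun f : X ⟶ Y => F.map f)) :
    Function.Bijective (fun f : X' ⟶ Y' => F.map f) := by
  constructor
  · intro f g hfg
    have : e.hom ≫ f ≫ e'.inv = e.hom ≫ g ≫ e'.inv := h.1 (by
      have : F.map f = F.map g := hfg
      simp [this])
    simpa using this
  · intro g
    obtain ⟨f, hf⟩ := h.2 (F.map e.hom ≫ g ≫ F.map e'.inv)
    have hf : F.map f = _ := hf
    refine ⟨e.inv ≫ f ≫ e'.hom, ?_⟩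
    change F.map (e.inv ≫ f ≫ e'.hom) = g
    simp [hf]

variable [HasShift A ℤ]

variable (F) in
/-- `F` induces bijections `Hom(X⟦a⟧, Y⟦b⟧) → Hom(F (X⟦a⟧), F (Y⟦b⟧))` for all `a` and `b`. -/
def ShiftHomBijective (X Y : A) : Prop :=
  ∀ a b : ℤ, Function.Bijective (fun f : X⟦a⟧ ⟶ Y⟦b⟧ => F.map f)

namespace ShiftHomBijective

lemma of_iso {X X' Y Y' : A} (h : F.ShiftHomBijective X Y) (e : X ≅ X') (e' : Y ≅ Y') :
    F.ShiftHomBijective X' Y' := fun a b =>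
  map_bijective_of_iso ((shiftFunctor A a).mapIso e) ((shiftFunctor A b).mapIso e') (h a b)

lemma shift {X Y : A} (h : F.ShiftHomBijective X Y) (n m : ℤ) :
    F.ShiftHomBijective (X⟦n⟧) (Y⟦m⟧) := fun a b =>
  map_bijective_of_iso ((shiftFunctorAdd A n a).app X) ((shiftFunctorAdd A m b).app Y)
    (h (n + a) (m + b))

lemma map_bijective {X Y : A} (h : F.ShiftHomBijective X Y) :
    Function.Bijective (fun f : X ⟶ Y => F.map f) :=
  map_bijective_of_iso ((shiftFunctorZero A ℤ).app X) ((shiftFunctorZero A ℤ).app Y) (h 0 0)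

/-- Shifting by `a` is an autoequivalence commuting with `F`, so `Hom(X⟦a⟧, Y⟦b⟧)` reduces to
`Hom(X, Y⟦b - a⟧)`. -/
lemma of_bijective [HasShift B ℤ] [F.CommShift ℤ] {X Y : A}
    (h : ∀ n : ℤ, Function.Bijective (fun f : X ⟶ Y⟦n⟧ => F.map f)) :
    F.ShiftHomBijective X Y := by
  intro a b
  refine map_bijective_of_iso (Iso.refl _)
    ((shiftFunctorAdd' A (b - a) a b (by simp)).app Y).symm ?_
  have hA : Function.Bijective (fun f : X ⟶ Y⟦b - a⟧ => f⟦a⟧') :=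
    (FullyFaithful.ofFullyFaithful (shiftFunctor A a)).map_bijective _ _
  have hB : Function.Bijective (fun f : F.obj X ⟶ F.obj (Y⟦b - a⟧) => f⟦a⟧') :=
    (FullyFaithful.ofFullyFaithful (shiftFunctor B a)).map_bijective _ _
  refine (Function.Bijective.of_comp_iff _ hA).1 ?_
  have h' : Function.Bijective (fun f => (F.commShiftIso a).hom.app X ≫ f ≫
      (F.commShiftIso a).inv.app (Y⟦b - a⟧)) :=
    ⟨fun f g hfg => by simpa using hfg, fun g =>
      ⟨(F.commShiftIso a).inv.app X ≫ g ≫ (F.commShiftIso a).hom.app _, by simp⟩⟩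
  refine Eq.mpr (congrArg Function.Bijective (funext fun f => ?_)) (h'.comp (hB.comp (h (b - a))))
  simp

end ShiftHomBijective

end

namespace ShiftHomBijective

open Pretriangulated

variable {A : Type*} [Category* A] [HasZeroObject A] [HasShift A ℤ] [Preadditive A]
  [∀ n : ℤ, (shiftFunctor A n).Additive] [Pretriangulated A]
  {B : Type*} [Category* B] [HasZeroObject B] [HasShift B ℤ] [Preadditive B]
  [∀ n : ℤ, (shiftFunctor B n).Additive] [Pretriangulated B]
  {F : A ⥤ B} [F.CommShift ℤ] [F.IsTriangulated]

/-- This is the five lemma for the long exact sequences of `Hom(-, Y)`. The outer terms involve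
`T.obj₁⟦1⟧` and `T.obj₃⟦-1⟧`, which is why the hypotheses cover all shifts. -/
lemma map_bijective_of_distTriang_left (T : Triangle A) (hT : T ∈ distTriang A) (Y : A)
    (h₁ : F.ShiftHomBijective T.obj₁ Y) (h₃ : F.ShiftHomBijective T.obj₃ Y) :
    Function.Bijective (fun f : T.obj₂ ⟶ Y => F.map f) := by
  have hFT := F.map_distinguished T hT
  have exact₂ : ∀ f : F.obj T.obj₂ ⟶ F.obj Y, F.map T.mor₁ ≫ f = 0 →
      ∃ g : F.obj T.obj₃ ⟶ F.obj Y, f = F.map T.mor₂ ≫ g :=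
    (F.mapTriangle.obj T).yoneda_exact₂ hFT
  have exact₃ : ∀ f : F.obj T.obj₃ ⟶ F.obj Y, F.map T.mor₂ ≫ f = 0 →
      ∃ g : (F.obj T.obj₁)⟦(1 : ℤ)⟧ ⟶ F.obj Y,
        f = (F.map T.mor₃ ≫ (F.commShiftIso (1 : ℤ)).hom.app T.obj₁) ≫ g :=
    (F.mapTriangle.obj T).yoneda_exact₃ hFT
  obtain ⟨d, hd, exact₁⟩ : ∃ d : T.obj₃⟦(-1 : ℤ)⟧ ⟶ T.obj₁, d ≫ T.mor₁ = 0 ∧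
      ∀ f : T.obj₁ ⟶ Y, d ≫ f = 0 → ∃ g : T.obj₂ ⟶ Y, f = T.mor₁ ≫ g :=
    ⟨_, comp_distTriang_mor_zero₁₂ _ (inv_rot_of_distTriang T hT),
      T.invRotate.yoneda_exact₂ (inv_rot_of_distTriang T hT)⟩
  have h₁' : Function.Surjective (fun f : T.obj₁⟦(1 : ℤ)⟧ ⟶ Y => F.map f) :=
    (map_bijective_of_iso (Iso.refl _) ((shiftFunctorZero A ℤ).app Y) (h₁ 1 0)).2
  have h₃' : Function.Injective (fun f : T.obj₃⟦(-1 : ℤ)⟧ ⟶ Y => F.map f) :=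
    (map_bijective_of_iso (Iso.refl _) ((shiftFunctorZero A ℤ).app Y) (h₃ (-1) 0)).1
  constructor
  · refine (injective_iff_map_eq_zero (F.mapAddHom (X := T.obj₂) (Y := Y))).2 fun f hf => ?_
    replace hf : F.map f = 0 := hf
    obtain ⟨g, rfl⟩ := T.yoneda_exact₂ hT f (h₁.map_bijective.1 (by simp [hf]))
    obtain ⟨k, hk⟩ := exact₃ (F.map g) (by rwa [← F.map_comp])
    obtain ⟨l, hl : F.map l = _⟩ := h₁' ((F.commShiftIso (1 : ℤ)).hom.app T.obj₁ ≫ k)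
    have : g = T.mor₃ ≫ l := h₃.map_bijective.1 (by simp [hl, hk])
    rw [this, comp_distTriang_mor_zero₂₃_assoc _ hT, zero_comp]
  · intro f'
    obtain ⟨g, hg : F.map g = F.map T.mor₁ ≫ f'⟩ := h₁.map_bijective.2 (F.map T.mor₁ ≫ f')
    -- The obstruction `d ≫ g` to extending `g` along `T.mor₁` vanishes after applying `F`, and `F`
    -- is injective on morphisms out of `T.obj₃⟦-1⟧`.
    obtain ⟨l, rfl⟩ := exact₁ g (h₃' (by
      change F.map (d ≫ g) = F.map 0
      rw [F.map_comp, hg, ← F.map_comp_assoc, hd, F.map_zero, zero_comp, F.map_zero]))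
    obtain ⟨k, hk⟩ := exact₂ (f' - F.map l) (by simp [Preadditive.comp_sub, ← hg])
    obtain ⟨m, hm : F.map m = k⟩ := h₃.map_bijective.2 k
    refine ⟨l + T.mor₂ ≫ m, ?_⟩
    change F.map (l + T.mor₂ ≫ m) = f'
    rw [F.map_add, F.map_comp, hm, ← hk, add_sub_cancel]

/-- The dual five lemma, for `Hom(X, -)`. -/
lemma map_bijective_of_distTriang_right (T : Triangle A) (hT : T ∈ distTriang A) (X : A)
    (h₁ : F.ShiftHomBijective X T.obj₁) (h₃ : F.ShiftHomBijective X T.obj₃) :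
    Function.Bijective (fun f : X ⟶ T.obj₂ => F.map f) := by
  have exact₂ : ∀ f : F.obj X ⟶ F.obj T.obj₂, f ≫ F.map T.mor₂ = 0 →
      ∃ g : F.obj X ⟶ F.obj T.obj₁, f = g ≫ F.map T.mor₁ :=
    (F.mapTriangle.obj T).coyoneda_exact₂ (F.map_distinguished T hT)
  obtain ⟨d, hd, exact₁⟩ : ∃ d : T.obj₃⟦(-1 : ℤ)⟧ ⟶ T.obj₁, d ≫ T.mor₁ = 0 ∧
      ∀ f : F.obj X ⟶ F.obj T.obj₁, f ≫ F.map T.mor₁ = 0 →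
        ∃ g : F.obj X ⟶ F.obj (T.obj₃⟦(-1 : ℤ)⟧), f = g ≫ F.map d :=
    ⟨_, comp_distTriang_mor_zero₁₂ _ (inv_rot_of_distTriang T hT),
      (F.mapTriangle.obj T.invRotate).coyoneda_exact₂
        (F.map_distinguished _ (inv_rot_of_distTriang T hT))⟩
  have h₃' : Function.Surjective (fun f : X ⟶ T.obj₃⟦(-1 : ℤ)⟧ => F.map f) :=
    (map_bijective_of_iso ((shiftFunctorZero A ℤ).app X) (Iso.refl _) (h₃ 0 (-1))).2
  have h₁' : Function.Injective (fun f : X ⟶ T.obj₁⟦(1 : ℤ)⟧ => F.map f) :=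
    (map_bijective_of_iso ((shiftFunctorZero A ℤ).app X) (Iso.refl _) (h₁ 0 1)).1
  constructor
  · refine (injective_iff_map_eq_zero (F.mapAddHom (X := X) (Y := T.obj₂))).2 fun f hf => ?_
    replace hf : F.map f = 0 := hf
    obtain ⟨g, rfl⟩ := T.coyoneda_exact₂ hT f (h₃.map_bijective.1 (by simp [hf]))
    obtain ⟨k, hk⟩ := exact₁ (F.map g) (by rwa [← F.map_comp])
    obtain ⟨l, hl : F.map l = k⟩ := h₃' k
    have : g = l ≫ d := h₁.map_bijective.1 (by simp [hl, hk])
    rw [this, Category.assoc, hd, comp_zero]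
  · intro f'
    obtain ⟨g, hg : F.map g = f' ≫ F.map T.mor₂⟩ := h₃.map_bijective.2 (f' ≫ F.map T.mor₂)
    obtain ⟨l, rfl⟩ := T.coyoneda_exact₃ hT g (h₁' (by
      change F.map (g ≫ T.mor₃) = F.map 0
      rw [F.map_comp, hg, Category.assoc, ← F.map_comp, comp_distTriang_mor_zero₂₃ _ hT,
        F.map_zero, comp_zero, F.map_zero]))
    obtain ⟨k, hk⟩ := exact₂ (f' - F.map l) (by simp [Preadditive.sub_comp, ← hg])
    obtain ⟨m, hm : F.map m = k⟩ := h₁.map_bijective.2 k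
    refine ⟨l + m ≫ T.mor₁, ?_⟩
    change F.map (l + m ≫ T.mor₁) = f'
    rw [F.map_add, F.map_comp, hm, ← hk, add_sub_cancel]

lemma of_distTriang_left (T : Triangle A) (hT : T ∈ distTriang A) (Y : A)
    (h₁ : F.ShiftHomBijective T.obj₁ Y) (h₃ : F.ShiftHomBijective T.obj₃ Y) :
    F.ShiftHomBijective T.obj₂ Y := fun a b =>
  map_bijective_of_distTriang_left _ (Triangle.shift_distinguished T hT a) _ (h₁.shift a b)
    (h₃.shift a b)

lemma of_distTriang_right (T : Triangle A) (hT : T ∈ distTriang A) (X : A)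
    (h₁ : F.ShiftHomBijective X T.obj₁) (h₃ : F.ShiftHomBijective X T.obj₃) :
    F.ShiftHomBijective X T.obj₂ := fun a b =>
  map_bijective_of_distTriang_right _ (Triangle.shift_distinguished T hT b) _ (h₁.shift a b)
    (h₃.shift a b)

end ShiftHomBijective

end Functor

/-! ### Bounded derived categories -/

section

open _root_.DerivedCategory Pretriangulated

variable {A : Type*} [Category* A] [Abelian A] {B : Type*} [Category* B] [Abelian B]

/-- Induction on the cohomological amplitude: the truncation triangle at `a + 1` splits off the
lowest degree, which is an object of `A` placed in degree `a`. -/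
lemma _root_.DerivedCategory.bounded_induction [HasDerivedCategory A]
    (P : ObjectProperty (DerivedCategory A)) [P.IsClosedUnderIsomorphisms]
    (hP : ∀ (X : A) (n : ℤ), P ((singleFunctor A n).obj X))
    (hP' : ∀ T ∈ distTriang (DerivedCategory A), P T.obj₁ → P T.obj₃ → P T.obj₂)
    (X : DerivedCategory A) (hX : (TStructure.t (C := A)).bounded X) : P X := by
  have key : ∀ (k : ℕ) (a : ℤ) (X : DerivedCategory A), X.IsGE a → X.IsLE (a + k) → P X := by
    intro k
    induction k with
    | zero =>
      intro a X h₁ h₂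
      simp only [Nat.cast_zero, add_zero] at h₂
      obtain ⟨Y, ⟨e⟩⟩ := exists_iso_singleFunctor_obj_of_isGE_of_isLE X a
      exact P.prop_of_iso e.symm (hP Y a)
    | succ k hk =>
      intro a X h₁ h₂
      refine hP' _ (TStructure.t.triangleLTGE_distinguished (a + 1) X) ?_ ?_
      · have h : (((TStructure.t (C := A)).truncLT (a + 1)).obj X).IsLE a := inferInstance
        have h' : (((TStructure.t (C := A)).truncLT (a + 1)).obj X).IsGE a := inferInstance
        obtain ⟨Y, ⟨e⟩⟩ := exists_iso_singleFunctor_obj_of_isGE_of_isLE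
          (((TStructure.t (C := A)).truncLT (a + 1)).obj X) a
        exact P.prop_of_iso e.symm (hP Y a)
      · refine hk (a + 1) (((TStructure.t (C := A)).truncGE (a + 1)).obj X) inferInstance ?_
        have : a + 1 + (k : ℤ) = a + ((k + 1 : ℕ) : ℤ) := by push_cast; ring
        rw [this]
        infer_instance
  obtain ⟨⟨a, ha⟩, ⟨b, hb⟩⟩ := hX
  refine key (b - a).toNat a X ha ?_
  -- Truncating `b - a` at zero is harmless: `b ≤ a + (b - a).toNat` also holds when `b < a`.
  exact TStructure.t.isLE_of_le X b _ (by have := Int.self_le_toNat (b - a); lia)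

variable (G : A ⥤ B) [G.Additive] [PreservesFiniteLimits G] [PreservesFiniteColimits G]

universe t t' w w'

lemma Functor.mapDerivedCategory_map_bijective_of_mapExt_bijective
    [HasDerivedCategory.{t} A] [HasDerivedCategory.{t'} B] [HasExt.{w} A] [HasExt.{w'} B]
    (X Y : A) (h : ∀ i : ℕ, Function.Bijective (G.mapExtAddHom (X := X) (Y := Y) (n := i)))
    (n : ℤ) : Function.Bijective (fun f : (singleFunctor A 0).obj X ⟶
      ((singleFunctor A 0).obj Y)⟦n⟧ => G.mapDerivedCategory.map f) := by
  -- For `n < 0` both Hom groups vanish by the t-structure; for `n ≥ 0` both are Ext groups, and the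
  -- map becomes the one on Ext after conjugation by `e` and `e'`.
  obtain hn | hn := lt_or_ge n 0
  · have h₁ : Subsingleton ((singleFunctor A 0).obj X ⟶ ((singleFunctor A 0).obj Y)⟦n⟧) := by
      have : (((singleFunctor A 0).obj Y)⟦n⟧).IsGE (-n) :=
        TStructure.t.isGE_shift _ 0 n (-n) (by lia)
      exact subsingleton_of_forall_eq 0 fun f =>
        TStructure.t.zero_of_isLE_of_isGE f 0 (-n) (by lia) inferInstance inferInstance
    have h₂ : Subsingleton (G.mapDerivedCategory.obj ((singleFunctor A 0).obj X) ⟶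
        G.mapDerivedCategory.obj (((singleFunctor A 0).obj Y)⟦n⟧)) := by
      let e := (G.mapDerivedCategorySingleFunctor 0).app X
      let e' := (G.mapDerivedCategory.commShiftIso n).app ((singleFunctor A 0).obj Y) ≪≫
        (shiftFunctor _ n).mapIso ((G.mapDerivedCategorySingleFunctor 0).app Y)
      have : (((singleFunctor B 0).obj (G.obj Y))⟦n⟧).IsGE (-n) :=
        TStructure.t.isGE_shift _ 0 n (-n) (by lia)
      have h₃ : Subsingleton ((singleFunctor B 0).obj (G.obj X) ⟶
          ((singleFunctor B 0).obj (G.obj Y))⟦n⟧) :=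
        subsingleton_of_forall_eq 0 fun f =>
          TStructure.t.zero_of_isLE_of_isGE f 0 (-n) (by lia) inferInstance inferInstance
      exact @Equiv.subsingleton _ _ (e.homCongr e') h₃
    exact ⟨fun _ _ _ => Subsingleton.elim _ _, fun g => ⟨0, Subsingleton.elim _ _⟩⟩
  · obtain ⟨i, rfl⟩ := Int.eq_ofNat_of_zero_le hn
    let e := (G.mapDerivedCategorySingleFunctor 0).app X
    let e' := (G.mapDerivedCategory.commShiftIso (i : ℤ)).app ((singleFunctor A 0).obj Y) ≪≫
      (shiftFunctor _ (i : ℤ)).mapIso ((G.mapDerivedCategorySingleFunctor 0).app Y)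
    refine (Function.Bijective.of_comp_iff' (e.homCongr e').bijective _).1 ?_
    refine (Function.Bijective.of_comp_iff _
      (Ext.homEquiv (X := X) (Y := Y) (n := i)).bijective).1 ?_
    refine Eq.mpr (congrArg Function.Bijective (funext fun x => ?_))
      ((Ext.homEquiv (X := G.obj X) (Y := G.obj Y) (n := i)).bijective.comp (h i))
    refine Eq.trans ?_ (Ext.mapExactFunctor_hom G x).symm
    simp [e, e', ShiftedHom.map, Iso.homCongr]

attribute [local instance] HasDerivedCategory.standard

variable {G}

lemma Functor.InducesExtIsos.shiftHomBijective (hG : G.InducesExtIsos)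
    (X Y : DerivedCategory A) (hX : (TStructure.t (C := A)).bounded X)
    (hY : (TStructure.t (C := A)).bounded Y) : G.mapDerivedCategory.ShiftHomBijective X Y := by
  have := HasExt.standard A
  have := HasExt.standard B
  have h₀ : ∀ (X Y : A) (n m : ℤ), G.mapDerivedCategory.ShiftHomBijective
      ((singleFunctor A n).obj X) ((singleFunctor A m).obj Y) := by
    intro X Y n m
    have := ShiftHomBijective.of_bijective (F := G.mapDerivedCategory)
      (G.mapDerivedCategory_map_bijective_of_mapExt_bijective X Y (hG X Y))
    exact (this.shift (-n) (-m)).of_iso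
      (((singleFunctors A).shiftIso (-n) n 0 (by simp)).app X)
      (((singleFunctors A).shiftIso (-m) m 0 (by simp)).app Y)
  let P (Y : DerivedCategory A) : ObjectProperty (DerivedCategory A) :=
    fun X => G.mapDerivedCategory.ShiftHomBijective X Y
  let P' (X : DerivedCategory A) : ObjectProperty (DerivedCategory A) :=
    fun Y => G.mapDerivedCategory.ShiftHomBijective X Y
  have hP (Y) : (P Y).IsClosedUnderIsomorphisms := ⟨fun e h => h.of_iso e (Iso.refl _)⟩
  have hP' (X) : (P' X).IsClosedUnderIsomorphisms := ⟨fun e h => h.of_iso (Iso.refl _) e⟩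
  -- Dévissage in the source for a fixed bounded target, then in the target with the source
  -- concentrated in one degree.
  refine bounded_induction (P Y) (fun X₀ n => ?_)
    (fun T hT h₁ h₃ => ShiftHomBijective.of_distTriang_left T hT Y h₁ h₃) X hX
  exact bounded_induction (P' _) (fun Y₀ m => h₀ _ _ _ _)
    (fun T hT h₁ h₃ => ShiftHomBijective.of_distTriang_right T hT _ h₁ h₃) Y hY

lemma Functor.InducesExtIsos.full_mapBoundedDerivedCategory (hG : G.InducesExtIsos) :
    G.mapBoundedDerivedCategory.Full where
  map_surjective {X Y} f := by
    obtain ⟨g, hg⟩ := (hG.shiftHomBijective X.obj Y.obj X.property Y.property).map_bijective.2 f.hom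
    exact ⟨ObjectProperty.homMk g, by ext; exact hg⟩

lemma Functor.InducesExtIsos.faithful_mapBoundedDerivedCategory (hG : G.InducesExtIsos) :
    G.mapBoundedDerivedCategory.Faithful where
  map_injective {X Y} f g h := by
    ext
    exact (hG.shiftHomBijective X.obj Y.obj X.property Y.property).map_bijective.1
      (congrArg (fun k : G.mapBoundedDerivedCategory.obj X ⟶ _ => k.hom) h)

end

end CategoryTheory

noncomputable section

/-! ### Elements of modules, exactness and representable modules -/

namespace ModCat

variable {C : Type u} [SmallCategory C] [Preadditive C]

/-- The map `M(X) → M(Y)` induced by `f : X ⟶ Y`. -/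
def act (M : ModCat C) {X Y : C} (f : X ⟶ Y) : M.obj.obj X →+ M.obj.obj Y := (M.obj.map f).hom

/-- The component `M(X) → N(X)` of a morphism of modules. -/
def app {M N : ModCat C} (φ : M ⟶ N) (X : C) : M.obj.obj X →+ N.obj.obj X := (φ.hom.app X).hom

section

variable (M : ModCat C) {X Y Z : C}

lemma act_id (x : M.obj.obj X) : M.act (𝟙 X) x = x :=
  ConcreteCategory.congr_hom (M.obj.map_id X) x

lemma act_comp (f : X ⟶ Y) (g : Y ⟶ Z) (x : M.obj.obj X) :
    M.act (f ≫ g) x = M.act g (M.act f x) :=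
  ConcreteCategory.congr_hom (M.obj.map_comp f g) x

lemma act_add (f g : X ⟶ Y) (x : M.obj.obj X) : M.act (f + g) x = M.act f x + M.act g x :=
  ConcreteCategory.congr_hom (M.obj.map_add (f := f) (g := g)) x

lemma act_zero (x : M.obj.obj X) : M.act (0 : X ⟶ Y) x = 0 :=
  ConcreteCategory.congr_hom (M.obj.map_zero X Y) x

lemma act_sub (f g : X ⟶ Y) (x : M.obj.obj X) : M.act (f - g) x = M.act f x - M.act g x :=
  ConcreteCategory.congr_hom (M.obj.map_sub (f := f) (g := g)) x

end

section

variable {M N L : ModCat C}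

lemma app_act (φ : M ⟶ N) {X Y : C} (f : X ⟶ Y) (x : M.obj.obj X) :
    app φ Y (M.act f x) = N.act f (app φ X x) :=
  ConcreteCategory.congr_hom (φ.hom.naturality f) x

lemma app_comp (φ : M ⟶ N) (ψ : N ⟶ L) {X : C} (x : M.obj.obj X) :
    app (φ ≫ ψ) X x = app ψ X (app φ X x) := rfl

lemma app_id {X : C} (x : M.obj.obj X) : app (𝟙 M) X x = x := rfl

lemma app_zero {X : C} (x : M.obj.obj X) : app (0 : M ⟶ N) X x = 0 := rfl

lemma hom_ext {φ ψ : M ⟶ N} (h : ∀ (X : C) (x : M.obj.obj X), app φ X x = app ψ X x) : φ = ψ := by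
  apply ObjectProperty.hom_ext
  ext X x
  exact h X x

/-- The morphism of modules with given components. -/
def ofApp (φ : ∀ X : C, M.obj.obj X →+ N.obj.obj X)
    (h : ∀ (X Y : C) (f : X ⟶ Y) (x : M.obj.obj X), φ Y (M.act f x) = N.act f (φ X x)) : M ⟶ N :=
  ObjectProperty.homMk
    { app := fun X => AddCommGrpCat.ofHom (φ X)
      naturality := fun X Y f => by
        ext x
        exact h X Y f x }

lemma epi_iff (φ : M ⟶ N) : Epi φ ↔ ∀ X : C, Function.Surjective (app φ X) := by
  rw [← (additiveFunctor C AddCommGrpCat.{u}).ι.epi_map_iff_epi φ, NatTrans.epi_iff_epi_app]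
  exact forall_congr' fun X => AddCommGrpCat.epi_iff_surjective _

lemma mono_iff (φ : M ⟶ N) : Mono φ ↔ ∀ X : C, Function.Injective (app φ X) := by
  rw [← (additiveFunctor C AddCommGrpCat.{u}).ι.mono_map_iff_mono φ, NatTrans.mono_iff_mono_app]
  exact forall_congr' fun X => AddCommGrpCat.mono_iff_injective _

/-- The inclusion into all functors is exact and faithful, and evaluations preserve homology, so
exactness is tested objectwise on elements. -/
lemma exact_iff (S : ShortComplex (ModCat C)) : S.Exact ↔
    ∀ (X : C) (x : S.X₂.obj.obj X), app S.g X x = 0 → ∃ y, app S.f X y = x := by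
  have h : S.Exact ↔ ∀ X : C, ((S.map (additiveFunctor C AddCommGrpCat.{u}).ι).map
      ((evaluation C AddCommGrpCat.{u}).obj X)).Exact := by
    rw [← ShortComplex.exact_map_iff_of_faithful S (additiveFunctor C AddCommGrpCat.{u}).ι,
      ShortComplex.exact_iff_isZero_homology, Functor.isZero_iff]
    refine forall_congr' fun X => ?_
    rw [ShortComplex.exact_iff_isZero_homology]
    exact (ShortComplex.mapHomologyIso _ ((evaluation C AddCommGrpCat.{u}).obj X)).symm.isZero_iff
  rw [h]
  exact forall_congr' fun X => ShortComplex.ab_exact_iff _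

lemma exact_of_isColimit {φ : M ⟶ N} (c : CokernelCofork φ) (hc : IsColimit c) (X : C)
    (x : N.obj.obj X) (hx : app c.π X x = 0) : ∃ y, app φ X y = x :=
  (exact_iff (ShortComplex.mk φ c.π c.condition)).1 (ShortComplex.exact_of_g_is_cokernel _
    (hc.ofIsoColimit (Cofork.ext (Iso.refl _)))) X x hx

end

section

variable {X Y : C} {M : ModCat C}

/-- A morphism `X ⟶ Y`, regarded as an element of the module `Hom_C(X, -)`. -/
def repElt : (X ⟶ Y) ≃+ (rep X).obj.obj Y := AddEquiv.refl _

lemma act_repElt (f : X ⟶ Y) {Z : C} (g : Y ⟶ Z) :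
    (rep X).act g (repElt f) = repElt (f ≫ g) := rfl

/-- The morphism `Hom_C(X, -) ⟶ M` corresponding to an element of `M(X)`. -/
def repHom (m : M.obj.obj X) : rep X ⟶ M :=
  ofApp (fun Y => AddMonoidHom.mk' (fun f : X ⟶ Y => M.act f m) (fun f g => M.act_add f g m))
    (fun _ _ f g => M.act_comp g f m)

lemma app_repHom (m : M.obj.obj X) (f : X ⟶ Y) : app (repHom m) Y (repElt f) = M.act f m := rfl

lemma app_repElt (φ : rep X ⟶ M) (f : X ⟶ Y) :
    app φ Y (repElt f) = M.act f (app φ X (repElt (𝟙 X))) := by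
  rw [← app_act, act_repElt, Category.id_comp]

lemma rep_hom_ext {φ ψ : rep X ⟶ M} (h : app φ X (repElt (𝟙 X)) = app ψ X (repElt (𝟙 X))) :
    φ = ψ := by
  refine hom_ext fun Y y => ?_
  obtain ⟨f, rfl⟩ := repElt.surjective y
  rw [app_repElt, h, ← app_repElt]

lemma app_repHom_id (m : M.obj.obj X) : app (repHom m) X (repElt (𝟙 X)) = m := M.act_id m

/-- By Yoneda, lifting a morphism out of `rep X` amounts to lifting one element through a
surjection. -/
instance : Projective (rep X) where
  factors {N L} f e he := by
    obtain ⟨n, hn⟩ := (epi_iff e).1 he X (app f X (repElt (𝟙 X)))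
    exact ⟨repHom n, rep_hom_ext (by rw [app_comp, app_repHom_id, hn])⟩

end

/-! ### Direct sums of modules -/

section

variable {J : Type u} (M : J → ModCat C)

/-- The direct sum of a family of modules. -/
def dsum : ModCat C :=
  ⟨{ obj := fun X => AddCommGrpCat.of (Π₀ j, (M j).obj.obj X)
     map := fun f => AddCommGrpCat.ofHom
       (DFinsupp.mapRange.addMonoidHom fun j => (M j).act f)
     map_id := fun X => by
       refine AddCommGrpCat.ext fun (x : Π₀ j, (M j).obj.obj X) => ?_
       exact DFinsupp.ext fun j => (M j).act_id (x j)
     map_comp := fun {X Y Z} f g => by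
       refine AddCommGrpCat.ext fun (x : Π₀ j, (M j).obj.obj X) => ?_
       exact DFinsupp.ext fun j => (M j).act_comp f g (x j) },
   ⟨fun {X Y f g} => by
       refine AddCommGrpCat.ext fun (x : Π₀ j, (M j).obj.obj X) => ?_
       exact DFinsupp.ext fun j => (M j).act_add f g (x j)⟩⟩

variable {M}

/-- The morphism between direct sums with given components. -/
def dsumMap {N : J → ModCat C} (φ : ∀ j, M j ⟶ N j) : dsum M ⟶ dsum N :=
  ofApp (fun X => DFinsupp.mapRange.addMonoidHom fun j => app (φ j) X)
    (fun X _ f (x : Π₀ j, (M j).obj.obj X) => DFinsupp.ext fun j => app_act (φ j) f (x j))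

lemma dsumMap_apply {N : J → ModCat C} (φ : ∀ j, M j ⟶ N j) {X : C} (x : Π₀ j, (M j).obj.obj X)
    (j : J) : (show Π₀ j, (N j).obj.obj X from app (dsumMap φ) X x) j = app (φ j) X (x j) := rfl

open Classical in
/-- The inclusion of a summand in a direct sum. -/
def dsumι (j : J) : M j ⟶ dsum M :=
  ofApp (fun X => DFinsupp.singleAddHom (fun j => (M j).obj.obj X) j)
    (fun _ _ f _ => (DFinsupp.mapRange_single
      (f := fun j => (M j).act f) (hf := fun _ => map_zero _)).symm)

lemma dsumι_map {N : J → ModCat C} (φ : ∀ j, M j ⟶ N j) (j : J) :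
    dsumι j ≫ dsumMap φ = φ j ≫ dsumι j := by
  classical
  exact hom_ext fun X _ => DFinsupp.mapRange_single (f := fun j => app (φ j) X)
    (hf := fun _ => map_zero _)

lemma dsum_hom_ext {N : ModCat C} {φ ψ : dsum M ⟶ N} (h : ∀ j, dsumι j ≫ φ = dsumι j ≫ ψ) :
    φ = ψ := by
  classical
  refine hom_ext fun X x => ?_
  have : app φ X = app ψ X := DFinsupp.addHom_ext (β := fun j => (M j).obj.obj X)
    fun j y => congrArg (fun k : M j ⟶ N => app k X y) (h j)
  rw [this]

open Classical in
/-- The morphism from a direct sum with given components. -/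
def dsumDesc {N : ModCat C} (φ : ∀ j, M j ⟶ N) : dsum M ⟶ N :=
  ofApp (fun X => DFinsupp.liftAddHom (β := fun j => (M j).obj.obj X) fun j => app (φ j) X)
    (fun X Y f x => by
      have : (DFinsupp.liftAddHom (β := fun j => (M j).obj.obj Y) fun j => app (φ j) Y).comp
          ((dsum M).act f) = (N.act f).comp
            (DFinsupp.liftAddHom (β := fun j => (M j).obj.obj X) fun j => app (φ j) X) := by
        refine DFinsupp.addHom_ext (β := fun j => (M j).obj.obj X) fun j y => ?_
        have h : (dsum M).act f (DFinsupp.single j y : Π₀ j, (M j).obj.obj X) =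
            (DFinsupp.single j ((M j).act f y) : Π₀ j, (M j).obj.obj Y) :=
          (app_act (dsumι (M := M) j) f y).symm
        refine (congrArg (DFinsupp.liftAddHom (β := fun j => (M j).obj.obj Y)
          fun j => app (φ j) Y) h).trans ?_
        refine (DFinsupp.liftAddHom_apply_single _ _ _).trans ?_
        refine Eq.trans ?_ (congrArg (N.act f) (DFinsupp.liftAddHom_apply_single _ _ _)).symm
        exact app_act (φ j) f y
      exact DFunLike.congr_fun this x)

lemma dsumι_desc {N : ModCat C} (φ : ∀ j, M j ⟶ N) (j : J) : dsumι j ≫ dsumDesc φ = φ j := by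
  classical
  exact hom_ext fun X x => DFinsupp.liftAddHom_apply_single (β := fun j => (M j).obj.obj X)
    (fun j => app (φ j) X) j x

instance [∀ j, Projective (M j)] : Projective (dsum M) where
  factors {N L} f e he :=
    ⟨dsumDesc fun j => Projective.factorThru (dsumι j ≫ f) e,
      dsum_hom_ext fun j => by rw [← Category.assoc, dsumι_desc, Projective.factorThru_comp]⟩

lemma shortExact_dsum {S : J → ShortComplex (ModCat C)} (hS : ∀ j, (S j).ShortExact)
    (w : dsumMap (fun j => (S j).f) ≫ dsumMap (fun j => (S j).g) = 0) :
    (ShortComplex.mk (dsumMap fun j => (S j).f) (dsumMap fun j => (S j).g) w).ShortExact := by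
  classical
  refine { exact := ?_, mono_f := ?_, epi_g := ?_ }
  · refine (exact_iff _).2 fun X (x : Π₀ j, (S j).X₂.obj.obj X) hx => ?_
    have h : ∀ j, ∃ y, app (S j).f X y = x j := fun j =>
      (exact_iff _).1 (hS j).exact X (x j)
        (DFunLike.congr_fun (show (_ : Π₀ j, (S j).X₃.obj.obj X) = 0 from hx) j)
    choose y hy using h
    -- The chosen preimages may be nonzero where `x` vanishes, so they are cut off to the support of
    -- `x`.
    refine ⟨(DFinsupp.mk x.support fun j => y j : Π₀ j, (S j).X₁.obj.obj X), ?_⟩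
    refine DFinsupp.ext fun j => ?_
    refine (dsumMap_apply _ _ j).trans ?_
    by_cases hj : x j = 0
    · simp [DFinsupp.mk_apply, hj]
    · simp [DFinsupp.mk_apply, hj, hy]
  · refine (mono_iff _).2 fun X (x : Π₀ j, (S j).X₁.obj.obj X) y hxy => ?_
    exact DFinsupp.ext fun j => (mono_iff _).1 (hS j).mono_f X
      (DFunLike.congr_fun (show (_ : Π₀ j, (S j).X₂.obj.obj X) = _ from hxy) j)
  · exact (epi_iff _).2 fun X =>
      (DFinsupp.mapRange_surjective _ fun j => map_zero (app (S j).g X)).2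
        fun j => (epi_iff _).1 (hS j).epi_g X

lemma exists_epi_dsum_rep (M : ModCat C) : ∃ (J : Type u) (X : J → C)
    (p : dsum (fun j => rep (X j)) ⟶ M), Epi p := by
  refine ⟨Σ X : C, M.obj.obj X, fun j => j.1, dsumDesc fun j => repHom j.2, ?_⟩
  refine (epi_iff _).2 fun X x => ⟨app (dsumι (M := fun j : Σ X : C, M.obj.obj X => rep j.1) ⟨X, x⟩)
    X (repElt (𝟙 X)), ?_⟩
  rw [← app_comp, dsumι_desc, app_repHom_id]

end

end ModCat

/-! ### Finitely presented modules -/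

namespace ModCat

open ZeroObject

variable {C : Type u} [SmallCategory C] [Preadditive C]

/-- A module `M` is finitely presented if and only if it is generated by one element
`m ∈ M(X₁)`, and the relations satisfied by `m` are generated by one morphism `a : X₁ ⟶ X₀`. -/
lemma isFinPres_iff (M : ModCat C) : IsFinPres C M ↔
    ∃ (X₀ X₁ : C) (a : X₁ ⟶ X₀) (m : M.obj.obj X₁),
      (∀ (Y : C) (y : M.obj.obj Y), ∃ g : X₁ ⟶ Y, M.act g m = y) ∧
      ∀ (Y : C) (g : X₁ ⟶ Y), M.act g m = 0 ↔ ∃ h : X₀ ⟶ Y, a ≫ h = g := by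
  constructor
  · rintro ⟨X₀, X₁, f, g, w, hS, hg⟩
    obtain ⟨a, ha⟩ := repElt.surjective (app f X₀ (repElt (𝟙 X₀)))
    have hf : ∀ (Y : C) (h : X₀ ⟶ Y), app f Y (repElt h) = repElt (a ≫ h) := fun Y h => by
      rw [app_repElt, ← ha, act_repElt]
    refine ⟨X₀, X₁, a, app g X₁ (repElt (𝟙 X₁)), fun Y y => ?_, fun Y k => ⟨fun hk => ?_, ?_⟩⟩
    · obtain ⟨k, hk⟩ := (epi_iff g).1 hg Y y
      obtain ⟨k, rfl⟩ := repElt.surjective k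
      exact ⟨k, by rw [← app_repElt, hk]⟩
    · rw [← app_repElt] at hk
      obtain ⟨h, hh⟩ := (exact_iff _).1 hS Y (repElt k) hk
      obtain ⟨h, rfl⟩ := repElt.surjective h
      exact ⟨h, repElt.injective ((hf Y h).symm.trans hh)⟩
    · rintro ⟨h, rfl⟩
      rw [← app_repElt, ← hf, ← app_comp, w, app_zero]
  · rintro ⟨X₀, X₁, a, m, hm, ha⟩
    refine ⟨X₀, X₁, repHom (repElt a), repHom m, ?_, ?_, ?_⟩
    · refine rep_hom_ext ?_
      rw [app_comp, app_repHom_id, app_repHom, app_zero]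
      exact (ha _ _).2 ⟨𝟙 _, Category.comp_id _⟩
    · refine (exact_iff _).2 fun Y y hy => ?_
      obtain ⟨k, rfl⟩ := repElt.surjective y
      obtain ⟨h, rfl⟩ := (ha _ _).1 ((app_repHom m k).symm.trans hy)
      exact ⟨repElt h, (app_repHom _ h).trans (act_repElt a h)⟩
    · refine (epi_iff _).2 fun Y y => ?_
      obtain ⟨k, rfl⟩ := hm Y y
      exact ⟨repElt k, app_repHom m k⟩

lemma IsFinPres.of_iso {M N : ModCat C} (e : M ≅ N) (hM : IsFinPres C M) : IsFinPres C N := by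
  obtain ⟨X₀, X₁, f, g, w, hS, hg⟩ := hM
  refine ⟨X₀, X₁, f, g ≫ e.hom, by rw [← Category.assoc, w, zero_comp], ?_, inferInstance⟩
  refine (exact_iff _).2 fun Y y hy => (exact_iff _).1 hS Y y ?_
  refine (mono_iff e.hom).1 inferInstance Y ?_
  rw [map_zero]
  exact hy

instance : (IsFinPres C).IsClosedUnderIsomorphisms := ⟨IsFinPres.of_iso⟩

lemma isFinPres_rep [HasZeroObject C] (X : C) : IsFinPres C (rep X) := by
  refine (isFinPres_iff _).2 ⟨0, X, 0, repElt (𝟙 X), fun Y y => ?_, fun Y g => ?_⟩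
  · obtain ⟨k, rfl⟩ := repElt.surjective y
    exact ⟨k, by rw [act_repElt, Category.id_comp]⟩
  · rw [act_repElt, Category.id_comp, EmbeddingLike.map_eq_zero_iff]
    exact ⟨fun h => ⟨0, by simp [h]⟩, by rintro ⟨h, rfl⟩; simp⟩

lemma isFinPres_of_isZero [HasZeroObject C] {M : ModCat C} (hM : IsZero M) : IsFinPres C M := by
  have h0 : ∀ (Y : C) (y : M.obj.obj Y), y = 0 := fun Y y =>
    congrArg (fun k : M ⟶ M => app k Y y) (hM.eq_of_src (𝟙 M) 0)
  refine (isFinPres_iff _).2 ⟨0, 0, 0, 0, fun Y y => ⟨0, ?_⟩, fun Y g => ⟨fun _ => ⟨0, ?_⟩, ?_⟩⟩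
  · rw [h0 Y y, map_zero]
  · exact (isZero_zero C).eq_of_src _ _
  · exact fun _ => map_zero _

/-- A finitely presented module which is projective in `Mod(C)` is projective in `mod(C)`. -/
lemma projective_finPres [(IsFinPres C).IsAbelianSubcategory] {M : FinPresMod C}
    (hM : Projective M.obj) : Projective M :=
  (IsFinPres C).ι.projective_of_map_projective hM

/-- If `mod(C)` has kernels, then these are kernels in `Mod(C)`. -/
lemma isClosedUnderKernels_of_hasKernels [HasZeroObject C] [HasKernels (FinPresMod C)] :
    (IsFinPres C).IsClosedUnderKernels where
  kernels_le := by
    rintro _ ⟨φ, c, hc, h⟩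
    rename_i M N
    let φ' : (⟨M, h.1⟩ : FinPresMod C) ⟶ ⟨N, h.2⟩ := ObjectProperty.homMk φ
    let K : FinPresMod C := kernel φ'
    let k : K ⟶ ⟨M, h.1⟩ := kernel.ι φ'
    have hk : k.hom ≫ φ = 0 := congrArg (fun l : K ⟶ ⟨N, h.2⟩ => l.hom) (kernel.condition φ')
    -- `i` compares the kernel in `mod(C)` with the one in `Mod(C)`. It is an isomorphism because
    -- elements are morphisms from representables, and these lie in `mod(C)`.
    obtain ⟨i, hi⟩ : ∃ i : K.obj ⟶ c.pt, i ≫ c.ι = k.hom :=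
      ⟨_, (KernelFork.IsLimit.lift' hc k.hom hk).2⟩
    have : Mono c.ι := Fork.IsLimit.mono hc
    have hlift (X : C) (x : c.pt.obj.obj X) :
        ∃ l : (⟨rep X, isFinPres_rep X⟩ : FinPresMod C) ⟶ K, l.hom ≫ i = repHom x := by
      refine ⟨kernel.lift φ' (ObjectProperty.homMk (repHom x ≫ c.ι)) ?_, ?_⟩
      · apply ObjectProperty.hom_ext
        change (repHom x ≫ c.ι) ≫ φ = 0
        rw [Category.assoc, c.condition, comp_zero]
      · rw [← cancel_mono c.ι, Category.assoc, hi]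
        exact congrArg InducedCategory.Hom.hom (kernel.lift_ι φ' _ _)
    have : Epi i := (epi_iff i).2 fun X x => by
      obtain ⟨l, hl⟩ := hlift X x
      exact ⟨app l.hom X (repElt (𝟙 X)), by rw [← app_comp, hl, app_repHom_id]⟩
    have : Mono i := (mono_iff i).2 fun X => (injective_iff_map_eq_zero _).2 fun x hx => by
      let l : (⟨rep X, isFinPres_rep X⟩ : FinPresMod C) ⟶ K := ObjectProperty.homMk (repHom x)
      have hl : l = 0 := by
        refine (cancel_mono (kernel.ι φ')).1 (Eq.trans ?_ zero_comp.symm)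
        apply ObjectProperty.hom_ext
        change repHom x ≫ k.hom = 0
        refine rep_hom_ext ?_
        rw [← hi, app_comp, app_comp, app_repHom_id, hx, map_zero, app_zero]
      have := congrArg (fun l : (⟨rep X, isFinPres_rep X⟩ : FinPresMod C) ⟶ K =>
        app l.hom X (repElt (𝟙 X))) hl
      exact (app_repHom_id x).symm.trans this
    have := isIso_of_mono_of_epi i
    exact IsFinPres.of_iso (asIso i) K.property

/-! ### Closure of `mod(C)` under cokernels and finite products. -/

variable [HasBinaryBiproducts C]

/-- If `M ⟶ N ⟶ Q ⟶ 0` is exact, `M` is generated by one element and `N` is finitely presented,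
then `Q` is finitely presented. -/
lemma IsFinPres.of_exact {M N Q : ModCat C} (hM : IsFinPres C M) (hN : IsFinPres C N)
    (φ : M ⟶ N) (ψ : N ⟶ Q) (w : φ ≫ ψ = 0) (hψ : ∀ Y : C, Function.Surjective (app ψ Y))
    (h : ∀ (Y : C) (y : N.obj.obj Y), app ψ Y y = 0 → ∃ x, app φ Y x = y) : IsFinPres C Q := by
  obtain ⟨-, X₁, -, m, hm, -⟩ := (isFinPres_iff _).1 hM
  obtain ⟨Y₀, Y₁, b, n, hn, hb⟩ := (isFinPres_iff _).1 hN
  -- `g` writes the image of the generator of `M` in terms of `n`; the relations of `Q` are those of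
  -- `N` together with `g`.
  obtain ⟨g, hg⟩ := hn _ (app φ X₁ m)
  refine (isFinPres_iff _).2 ⟨Y₀ ⊞ X₁, Y₁, biprod.lift b g, app ψ Y₁ n, fun Z z => ?_,
    fun Z k => ?_⟩
  · obtain ⟨y, rfl⟩ := hψ Z z
    obtain ⟨k, rfl⟩ := hn Z y
    exact ⟨k, (app_act _ _ _).symm⟩
  · rw [← app_act]
    constructor
    · intro hk
      obtain ⟨x, hx⟩ := h _ _ hk
      obtain ⟨l, rfl⟩ := hm Z x
      obtain ⟨r, hr⟩ := (hb Z (k - g ≫ l)).1 (by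
        rw [act_sub, act_comp, hg, ← app_act, hx, sub_self])
      exact ⟨biprod.desc r l, by rw [biprod.lift_desc, hr, sub_add_cancel]⟩
    · rintro ⟨r, rfl⟩
      rw [biprod.lift_eq, Preadditive.add_comp, act_add, map_add, Category.assoc, Category.assoc,
        (hb Z (b ≫ _)).2 ⟨_, rfl⟩, map_zero, zero_add, act_comp, hg, ← app_act, ← app_comp, w,
        app_zero]

lemma IsFinPres.biprod {M N : ModCat C} (hM : IsFinPres C M) (hN : IsFinPres C N) :
    IsFinPres C (M ⊞ N) := by
  obtain ⟨X₀, X₁, a, m, hm, ha⟩ := (isFinPres_iff _).1 hM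
  obtain ⟨Y₀, Y₁, b, n, hn, hb⟩ := (isFinPres_iff _).1 hN
  have h₁ (Z : C) (x : M.obj.obj Z) : app (biprod.fst : M ⊞ N ⟶ M) Z (app biprod.inl Z x) = x := by
    rw [← app_comp, biprod.inl_fst, app_id]
  have h₂ (Z : C) (x : M.obj.obj Z) : app (biprod.snd : M ⊞ N ⟶ N) Z (app biprod.inl Z x) = 0 := by
    rw [← app_comp, biprod.inl_snd, app_zero]
  have h₃ (Z : C) (x : N.obj.obj Z) : app (biprod.fst : M ⊞ N ⟶ M) Z (app biprod.inr Z x) = 0 := by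
    rw [← app_comp, biprod.inr_fst, app_zero]
  have h₄ (Z : C) (x : N.obj.obj Z) : app (biprod.snd : M ⊞ N ⟶ N) Z (app biprod.inr Z x) = x := by
    rw [← app_comp, biprod.inr_snd, app_id]
  have h₅ (Z : C) (x : (M ⊞ N).obj.obj Z) :
      app biprod.inl Z (app biprod.fst Z x) + app biprod.inr Z (app biprod.snd Z x) = x :=
    congrArg (fun k : M ⊞ N ⟶ M ⊞ N => app k Z x) biprod.total
  have h (Z : C) (k : X₁ ⊞ Y₁ ⟶ Z) : (M ⊞ N).act k
      (app biprod.inl (X₁ ⊞ Y₁) (M.act biprod.inl m) +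
        app biprod.inr (X₁ ⊞ Y₁) (N.act biprod.inr n)) =
      app biprod.inl Z (M.act (biprod.inl ≫ k) m) + app biprod.inr Z (N.act (biprod.inr ≫ k) n) := by
    rw [map_add, act_comp, act_comp, app_act, app_act]
    simp only [app_act]
  refine (isFinPres_iff _).2 ⟨X₀ ⊞ Y₀, X₁ ⊞ Y₁, biprod.map a b,
    app biprod.inl (X₁ ⊞ Y₁) (M.act biprod.inl m) + app biprod.inr (X₁ ⊞ Y₁) (N.act biprod.inr n),
    fun Z z => ?_, fun Z k => ?_⟩
  · obtain ⟨k, hk⟩ := hm Z (app biprod.fst Z z)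
    obtain ⟨l, hl⟩ := hn Z (app biprod.snd Z z)
    refine ⟨biprod.desc k l, ?_⟩
    rw [h, biprod.inl_desc, biprod.inr_desc, hk, hl, h₅]
  · rw [h]
    constructor
    · intro hk
      obtain ⟨r, hr⟩ := (ha Z (biprod.inl ≫ k)).1 (by
        have := congrArg (app biprod.fst Z) hk
        rwa [map_add, h₁, h₃, add_zero, map_zero] at this)
      obtain ⟨s, hs⟩ := (hb Z (biprod.inr ≫ k)).1 (by
        have := congrArg (app biprod.snd Z) hk
        rwa [map_add, h₂, h₄, zero_add, map_zero] at this)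
      exact ⟨biprod.desc r s, biprod.hom_ext' _ _ (by simp [hr]) (by simp [hs])⟩
    · rintro ⟨r, rfl⟩
      rw [biprod.inl_map_assoc, biprod.inr_map_assoc, (ha _ _).2 ⟨_, rfl⟩, (hb _ _).2 ⟨_, rfl⟩,
        map_zero, map_zero, add_zero]

instance : (IsFinPres C).IsClosedUnderCokernels where
  cokernels_le := by
    rintro _ ⟨φ, c, hc, h⟩
    have : Epi c.π := Cofork.IsColimit.epi hc
    exact IsFinPres.of_exact h.1 h.2 φ c.π c.condition ((epi_iff _).1 inferInstance)
      (exact_of_isColimit c hc)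

variable [HasZeroObject C]

instance : (IsFinPres C).ContainsZero where
  exists_zero := ⟨0, isZero_zero _, isFinPres_of_isZero (isZero_zero _)⟩

instance : (IsFinPres C).IsClosedUnderFiniteProducts := by
  have h₁ : (IsFinPres C).IsClosedUnderBinaryProducts := ⟨by
    rintro P ⟨p⟩
    let c : BinaryFan (p.diag.obj ⟨.left⟩) (p.diag.obj ⟨.right⟩) :=
      (Cone.postcompose (diagramIsoPair p.diag).hom).obj (Cone.mk _ p.π)
    have hc : IsLimit c := (IsLimit.postcomposeHomEquiv (diagramIsoPair p.diag) _).symm p.isLimit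
    exact IsFinPres.of_iso ((BinaryBiproduct.isLimit _ _).conePointUniqueUpToIso hc)
      ((p.prop_diag_obj ⟨.left⟩).biprod (p.prop_diag_obj ⟨.right⟩))⟩
  exact .mk'

lemma isAbelianSubcategory_isFinPres (h : (IsFinPres C).IsClosedUnderKernels) :
    (IsFinPres C).IsAbelianSubcategory where

end ModCat

/-- Only kernels are at stake. Cokernels exist in `mod(Cᵒᵖ)`, the duality carries them to kernels in
`mod(C)`, and such kernels are kernels in `Mod(C)`. -/
lemma IsDualizingVariety.isAbelianSubcategory_isFinPres {R : Type u} [CommRing R] {C : Type u}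
    [SmallCategory C] [Preadditive C] [Linear R C] (hC : IsDualizingVariety R C) :
    (ModCat.IsFinPres C).IsAbelianSubcategory := by
  have := hC.additive
  have : HasBinaryBiproducts C := hasBinaryBiproducts_of_finite_biproducts C
  obtain ⟨E, _, _, ι, h, -, he⟩ := hC.dualizing
  have : HasCoequalizers (FinPresMod Cᵒᵖ) := Preadditive.hasCoequalizers_of_hasCokernels
  have : HasCoequalizers (FinPresMod C)ᵒᵖ :=
    Adjunction.hasColimitsOfShape_of_equivalence (dualFunctorFinPres R C E h)
  have : HasColimitsOfShape WalkingParallelPairᵒᵖ (FinPresMod C)ᵒᵖ :=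
    hasColimitsOfShape_of_equivalence walkingParallelPairOpEquiv
  have : HasEqualizers (FinPresMod C) := hasLimitsOfShape_of_hasColimitsOfShape_op
  exact ModCat.isAbelianSubcategory_isFinPres ModCat.isClosedUnderKernels_of_hasKernels

/-! ### Modules over quotient categories -/

namespace CatIdeal

open ModCat

variable {C : Type u} [SmallCategory C] [Preadditive C] (I : CatIdeal C)

lemma proj_map_eq_iff {X Y : C} (f g : X ⟶ Y) :
    I.proj.map f = I.proj.map g ↔ f - g ∈ I.hom X Y :=
  Quotient.functor_map_eq_iff I.rel f g

lemma proj_map_eq_zero_iff {X Y : C} (f : X ⟶ Y) : I.proj.map f = 0 ↔ f ∈ I.hom X Y := by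
  rw [← I.proj.map_zero, proj_map_eq_iff, sub_zero]

/-- `π` is full and essentially surjective, so precomposition with it is fully faithful. -/
instance : I.pushforward.Full :=
  haveI : ((additiveFunctor I.Quot AddCommGrpCat.{u}).ι ⋙
    (Functor.whiskeringLeft C I.Quot AddCommGrpCat.{u}).obj I.proj).Full := inferInstance
  inferInstance

instance : I.pushforward.Faithful :=
  haveI : ((additiveFunctor I.Quot AddCommGrpCat.{u}).ι ⋙
    (Functor.whiskeringLeft C I.Quot AddCommGrpCat.{u}).obj I.proj).Faithful := inferInstance
  inferInstance

instance [HasFiniteBiproducts C] : HasFiniteBiproducts I.Quot :=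
  haveI : HasFiniteProducts I.Quot := I.proj.hasFiniteProducts_of_additive_of_essSurj
  HasFiniteBiproducts.of_hasFiniteProducts

lemma act_pushforward (F : ModCat I.Quot) {X Y : C} (f : X ⟶ Y) (x : F.obj.obj (I.proj.obj X)) :
    (I.pushforward.obj F).act f x = F.act (I.proj.map f) x := rfl

/-- The ideal `I` is left finite if each module `I(X, -)` is generated by one element. -/
def IsLeftFinite : Prop :=
  ∀ X : C, ∃ (Z : C) (b : X ⟶ Z), ∀ (Y : C) (f : X ⟶ Y), f ∈ I.hom X Y ↔ ∃ g : Z ⟶ Y, b ≫ g = f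

variable {I} in
lemma IsLeftFinite.isFinPres_pushforward [HasBinaryBiproducts C] (hI : I.IsLeftFinite)
    (F : ModCat I.Quot) (hF : IsFinPres I.Quot F) : IsFinPres C (I.pushforward.obj F) := by
  obtain ⟨⟨X₀⟩, ⟨X₁⟩, a, m, hm, ha⟩ := (isFinPres_iff _).1 hF
  obtain ⟨a, rfl⟩ := I.proj.map_surjective (X := X₁) (Y := X₀) a
  obtain ⟨Z, b, hb⟩ := hI X₁
  -- Over `C` the relations on `m` are the lifted relation `a` and the elements of `I(X₁, -)`,
  -- generated by `b`.
  refine (isFinPres_iff _).2 ⟨X₀ ⊞ Z, X₁, biprod.lift a b, m, fun Y y => ?_, fun Y g => ?_⟩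
  · obtain ⟨g, hg⟩ := hm _ y
    obtain ⟨g, rfl⟩ := I.proj.map_surjective (X := X₁) (Y := Y) g
    exact ⟨g, hg⟩
  · refine (ha (I.proj.obj Y) (I.proj.map g)).trans ⟨?_, ?_⟩
    · rintro ⟨h, hh⟩
      obtain ⟨h, rfl⟩ := I.proj.map_surjective (X := X₀) (Y := Y) h
      replace hh : I.proj.map g = I.proj.map (a ≫ h) := hh.symm.trans (I.proj.map_comp a h).symm
      obtain ⟨l, hl⟩ := (hb Y _).1 ((I.proj_map_eq_iff _ _).1 hh)
      exact ⟨biprod.desc h l, by rw [biprod.lift_desc, hl, add_sub_cancel]⟩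
    · rintro ⟨h, rfl⟩
      refine ⟨I.proj.map (biprod.inl ≫ h), ?_⟩
      refine (I.proj.map_comp a (biprod.inl ≫ h)).symm.trans ((I.proj_map_eq_iff _ _).2 ?_)
      rw [biprod.lift_eq, Preadditive.add_comp, Category.assoc, Category.assoc, sub_add_cancel_left]
      exact neg_mem ((hb _ _).2 ⟨_, rfl⟩)

lemma isFinPres_of_isFinPres_pushforward (F : ModCat I.Quot)
    (hF : IsFinPres C (I.pushforward.obj F)) : IsFinPres I.Quot F := by
  obtain ⟨X₀, X₁, a, m, hm, ha⟩ := (isFinPres_iff _).1 hF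
  refine (isFinPres_iff _).2 ⟨I.proj.obj X₀, I.proj.obj X₁, I.proj.map a, m, ?_, ?_⟩
  · rintro ⟨Y⟩ y
    obtain ⟨g, hg⟩ := hm Y y
    exact ⟨I.proj.map g, hg⟩
  · rintro ⟨Y⟩ g
    obtain ⟨g, rfl⟩ := I.proj.map_surjective (X := X₁) (Y := Y) g
    refine (ha Y g).trans ⟨?_, ?_⟩
    · rintro ⟨h, rfl⟩
      exact ⟨I.proj.map h, (I.proj.map_comp a h).symm⟩
    · rintro ⟨h, hh⟩
      obtain ⟨h, rfl⟩ := I.proj.map_surjective (X := X₀) (Y := Y) h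
      refine (ha Y g).1 ?_
      rw [act_pushforward, ← hh]
      refine (F.act_comp (I.proj.map a) (I.proj.map h) m).trans ?_
      refine (congrArg (F.act (I.proj.map h)) ((ha X₀ a).2 ⟨𝟙 _, Category.comp_id _⟩)).trans ?_
      exact map_zero _

variable {I} in
-- `π_*` preserves kernels and both preserves and detects finite presentation, so closure under
-- kernels is inherited from `mod(C)`.
lemma IsLeftFinite.isAbelianSubcategory_isFinPres_quot [HasFiniteBiproducts C]
    (hI : I.IsLeftFinite) [(IsFinPres C).IsAbelianSubcategory] :
    (IsFinPres I.Quot).IsAbelianSubcategory := by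
  have : HasBinaryBiproducts C := hasBinaryBiproducts_of_finite_biproducts C
  have : HasBinaryBiproducts I.Quot := hasBinaryBiproducts_of_finite_biproducts I.Quot
  refine ModCat.isAbelianSubcategory_isFinPres ⟨?_⟩
  rintro _ ⟨φ, c, hc, h⟩
  refine I.isFinPres_of_isFinPres_pushforward _ ?_
  exact (IsFinPres C).prop_of_isLimit_kernelFork (KernelFork.mapIsLimit c hc I.pushforward)
    (hI.isFinPres_pushforward _ h.1) (hI.isFinPres_pushforward _ h.2)

/-! ### The canonical presentation of the representable modules over the quotient category -/

/-- The inclusion `I(X, -) ⟶ Hom_C(X, -)`. -/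
def leftModuleι (X : C) : I.leftModule X ⟶ rep X :=
  ofApp (fun Y => (I.hom X Y).subtype) (fun _ _ _ _ => rfl)

/-- The projection `Hom_C(X, -) ⟶ π_* Hom_{C/I}(π X, -)`. -/
def repProj (X : C) : rep X ⟶ I.pushforward.obj (rep (I.proj.obj X)) :=
  ofApp (fun _ => I.proj.mapAddHom) (fun _ _ f g => I.proj.map_comp g f)

lemma leftModuleι_repProj (X : C) : I.leftModuleι X ≫ I.repProj X = 0 :=
  hom_ext fun _ f => (I.proj_map_eq_zero_iff _).2 f.2

/-- The short complex `I(X, -) ⟶ Hom_C(X, -) ⟶ π_* Hom_{C/I}(π X, -)`. -/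
abbrev repShortComplex (X : C) : ShortComplex (ModCat C) :=
  ShortComplex.mk _ _ (I.leftModuleι_repProj X)

lemma repShortComplex_shortExact (X : C) : (I.repShortComplex X).ShortExact where
  exact := (exact_iff _).2 fun _ f hf => ⟨⟨f, (I.proj_map_eq_zero_iff _).1 hf⟩, rfl⟩
  mono_f := (mono_iff _).2 fun _ => Subtype.val_injective
  epi_g := (epi_iff _).2 fun _ => I.proj.map_surjective

/-- `I(X, -)` is the kernel of a morphism between finitely presented modules; this puts the
length-one resolution inside `mod(C)`. -/
lemma isFinPres_leftModule [HasZeroObject C] [HasZeroObject I.Quot]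
    [(IsFinPres C).IsAbelianSubcategory]
    (h : ∀ F, IsFinPres I.Quot F → IsFinPres C (I.pushforward.obj F)) (X : C) :
    IsFinPres C (I.leftModule X) := by
  have hS := I.repShortComplex_shortExact X
  have := hS.mono_f
  exact (IsFinPres C).prop_of_isLimit_kernelFork hS.exact.fIsKernel (isFinPres_rep X)
    (h _ (isFinPres_rep _))

/-! ### Comparison of Ext groups -/

lemma isStronglyIdempotent_of_projective
    (hproj : ∀ X, Projective (I.leftModule X))
    (hzero : ∀ (X : C) (F : ModCat I.Quot) (φ : I.leftModule X ⟶ I.pushforward.obj F), φ = 0) :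
    I.IsStronglyIdempotent := by
  have := HasExt.standard (ModCat I.Quot)
  have := HasExt.standard (ModCat C)
  refine I.pushforward.mapExt_bijective_of_acyclic fun F => ?_
  obtain ⟨J, X, p, hp⟩ := exists_epi_dsum_rep F
  refine ⟨_, p, hp, inferInstance, fun Y n => ?_⟩
  -- `π_*` of the direct sum of representables is definitionally the direct sum of their images, so
  -- the summed sequences resolve it.
  have hS := shortExact_dsum (fun j => I.repShortComplex_shortExact (X j).as)
    (dsum_hom_ext fun j => by
      rw [← Category.assoc, dsumι_map, Category.assoc, dsumι_map, ← Category.assoc,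
        ShortComplex.zero, zero_comp, comp_zero])
  exact Abelian.Ext.subsingleton_of_shortExact_projective hS (I.pushforward.obj Y)
    (fun f => dsum_hom_ext fun j => (hzero _ _ _).trans comp_zero.symm) n

lemma inducesExtIsos_pushforwardFinPres
    (hproj : ∀ X, Projective (I.leftModule X))
    (hzero : ∀ (X : C) (F : ModCat I.Quot) (φ : I.leftModule X ⟶ I.pushforward.obj F), φ = 0)
    [HasZeroObject C] [HasZeroObject I.Quot]
    [(IsFinPres C).IsAbelianSubcategory] [(IsFinPres I.Quot).IsAbelianSubcategory]
    (h : ∀ F, IsFinPres I.Quot F → IsFinPres C (I.pushforward.obj F)) :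
    (I.pushforwardFinPres h).InducesExtIsos := by
  have := HasExt.standard (FinPresMod I.Quot)
  have := HasExt.standard (FinPresMod C)
  refine (I.pushforwardFinPres h).mapExt_bijective_of_acyclic fun F => ?_
  -- A finitely presented module is covered by a single representable, so no infinite direct sum,
  -- which could leave `mod`, is needed.
  obtain ⟨-, X, -, g, -, -, hg⟩ := F.property
  refine ⟨⟨rep X, isFinPres_rep X⟩, ObjectProperty.homMk g,
    (IsFinPres I.Quot).ι.epi_of_epi_map hg, projective_finPres inferInstance, fun Y n => ?_⟩
  let S : ShortComplex (FinPresMod C) :=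
    { X₁ := ⟨I.leftModule X.as, I.isFinPres_leftModule h X.as⟩
      X₂ := ⟨rep X.as, isFinPres_rep X.as⟩
      X₃ := (I.pushforwardFinPres h).obj ⟨rep X, isFinPres_rep X⟩
      f := ObjectProperty.homMk (I.leftModuleι X.as)
      g := ObjectProperty.homMk (I.repProj X.as)
      zero := ObjectProperty.hom_ext _ (I.leftModuleι_repProj X.as) }
  have hS : S.ShortExact := by
    have hS' : (S.map (IsFinPres C).ι).ShortExact := I.repShortComplex_shortExact X.as
    exact
      { exact := (ShortComplex.exact_map_iff_of_faithful S (IsFinPres C).ι).1 hS'.exact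
        mono_f := (IsFinPres C).ι.mono_of_mono_map hS'.mono_f
        epi_g := (IsFinPres C).ι.epi_of_epi_map hS'.epi_g }
  have : Projective S.X₁ := projective_finPres (hproj X.as)
  have : Projective S.X₂ := projective_finPres (inferInstanceAs (Projective (rep X.as)))
  exact Abelian.Ext.subsingleton_of_shortExact_projective hS ((I.pushforwardFinPres h).obj Y)
    (fun f => ObjectProperty.hom_ext _ (hzero X.as Y.obj f.hom)) n

/-! ### The trace ideal of a representable module -/

section

variable {X : C}

/-- By Yoneda a morphism `rep X ⟶ rep X'` is precomposition with some `X' ⟶ X`, so the trace is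
additively generated by composites through `X`. -/
lemma traceIdeal_induction {X' Y : C} {P : (X' ⟶ Y) → Prop}
    (hcomp : ∀ (g : X' ⟶ X) (h : X ⟶ Y), P (g ≫ h)) (hadd : ∀ f g, P f → P g → P (f + g))
    {f : X' ⟶ Y} (hf : f ∈ (traceIdeal (rep X)).hom X' Y) : P f := by
  refine AddSubgroup.iSup_induction (C := P) _ hf ?_ ?_ hadd
  · rintro φ _ ⟨h, rfl⟩
    obtain ⟨h, rfl⟩ := repElt.surjective h
    exact (app_repElt φ h) ▸ hcomp (repElt.symm (app φ X (repElt (𝟙 X)))) h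
  · simpa using hcomp 0 0

lemma comp_mem_traceIdeal {X' Y : C} (g : X' ⟶ X) (h : X ⟶ Y) :
    g ≫ h ∈ (traceIdeal (rep X)).hom X' Y :=
  le_iSup (fun f : rep X ⟶ rep X' => (f.hom.app Y).hom.range) (repHom (repElt g)) ⟨repElt h, rfl⟩

lemma isLeftFinite_traceIdeal (R : Type u) [CommRing R] [Linear R C] [HasFiniteBiproducts C]
    (hfin : ∀ X' : C, Module.Finite R (X' ⟶ X)) : (traceIdeal (rep X)).IsLeftFinite := by
  intro X'
  have := hfin X'
  obtain ⟨n, s, hs⟩ := Module.Finite.exists_fin (R := R) (M := X' ⟶ X)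
  -- The `R`-generators `s` of `Hom(X', X)` assemble into one morphism `X' ⟶ Xⁿ` through which every
  -- morphism of the ideal factors.
  refine ⟨⨁ fun _ : Fin n => X, biproduct.lift s, fun Y f => ⟨fun hf => ?_, ?_⟩⟩
  · refine traceIdeal_induction (P := fun f => ∃ g, biproduct.lift s ≫ g = f) (fun g h => ?_) ?_ hf
    · have hg : g ∈ Submodule.span R (Set.range s) := hs ▸ Submodule.mem_top
      induction hg using Submodule.span_induction with
      | mem g hg =>
        obtain ⟨i, rfl⟩ := hg
        exact ⟨biproduct.π _ i ≫ h, by simp⟩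
      | zero => exact ⟨0, by simp⟩
      | add g g' _ _ hg hg' =>
        obtain ⟨k, hk⟩ := hg
        obtain ⟨k', hk'⟩ := hg'
        exact ⟨k + k', by rw [Preadditive.comp_add, hk, hk', Preadditive.add_comp]⟩
      | smul r g _ hg =>
        obtain ⟨k, hk⟩ := hg
        exact ⟨r • k, by rw [Linear.comp_smul, hk, Linear.smul_comp]⟩
    · rintro _ _ ⟨k, rfl⟩ ⟨k', rfl⟩
      exact ⟨k + k', Preadditive.comp_add _ _ _ _ _ _⟩
  · rintro ⟨g, rfl⟩
    have : biproduct.lift s ≫ g = ∑ i, s i ≫ biproduct.ι (fun _ : Fin n => X) i ≫ g := by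
      rw [biproduct.lift_eq, Preadditive.sum_comp]
      simp
    rw [this]
    exact sum_mem fun i _ => comp_mem_traceIdeal _ _

/-- `𝟙 X` lies in the ideal, so `F` vanishes at `π X`; and `I(X', -)` is generated by its elements
at `X`. -/
lemma leftModule_traceIdeal_hom_eq_zero (X' : C) (F : ModCat (traceIdeal (rep X)).Quot)
    (φ : (traceIdeal (rep X)).leftModule X' ⟶ (traceIdeal (rep X)).pushforward.obj F) : φ = 0 := by
  have h0 (x : F.obj.obj ((traceIdeal (rep X)).proj.obj X)) : x = 0 := by
    have : 𝟙 ((traceIdeal (rep X)).proj.obj X) = 0 := by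
      rw [← CategoryTheory.Functor.map_id]
      exact ((traceIdeal (rep X)).proj_map_eq_zero_iff _).2
        (Category.comp_id (𝟙 X) ▸ comp_mem_traceIdeal (𝟙 X) (𝟙 X))
    rw [← F.act_id x, this, F.act_zero]
  refine hom_ext fun Y f => ?_
  obtain ⟨f, hf⟩ := f
  -- Quantifying over the membership proof makes the statement a predicate on the bare morphism `f`,
  -- as the induction requires.
  suffices ∃ hf, app φ Y ⟨f, hf⟩ = 0 from this.2
  refine traceIdeal_induction (P := fun f => ∃ hf, app φ Y ⟨f, hf⟩ = 0) (fun g h => ?_)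
    (fun f g hf hg => ?_) hf
  · have hg : g ∈ (traceIdeal (rep X)).hom X' X := Category.comp_id g ▸ comp_mem_traceIdeal g (𝟙 X)
    refine ⟨comp_mem_traceIdeal g h, (app_act φ h ⟨g, hg⟩).trans ?_⟩
    exact (congrArg _ (h0 _)).trans (map_zero _)
  · obtain ⟨hf, hf'⟩ := hf
    obtain ⟨hg, hg'⟩ := hg
    refine ⟨add_mem hf hg, (map_add (app φ Y) ⟨f, hf⟩ ⟨g, hg⟩).trans ?_⟩
    rw [hf', hg', add_zero]

end

end CatIdeal

end

theorem mainTheorem5 {R : Type u} [CommRing R] {C : Type u} [SmallCategory C] [Preadditive C]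
    [Linear R C] (hC : IsDualizingVariety R C) (X : C) (I : CatIdeal C)
    (hI : I = CatIdeal.traceIdeal (ModCat.rep X))
    (hproj : ∀ X' : C, Projective (I.leftModule X')) :
    I.IsStronglyIdempotent ∧
    ∃ (_ : (ModCat.IsFinPres C).IsAbelianSubcategory)
      (_ : (ModCat.IsFinPres I.Quot).IsAbelianSubcategory)
      (h : ∀ F, ModCat.IsFinPres I.Quot F → ModCat.IsFinPres C (I.pushforward.obj F)),
      (I.pushforwardFinPres h).InducesExtIsos ∧
      (I.pushforwardFinPres h).mapBoundedDerivedCategory.Full ∧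
      (I.pushforwardFinPres h).mapBoundedDerivedCategory.Faithful := by
  subst hI
  have := hC.additive
  have : HasBinaryBiproducts C := hasBinaryBiproducts_of_finite_biproducts C
  have hzero := CatIdeal.leftModule_traceIdeal_hom_eq_zero (X := X)
  have hfin := CatIdeal.isLeftFinite_traceIdeal (X := X) R (fun X' => hC.hom_finite X' X)
  have h₁ := hC.isAbelianSubcategory_isFinPres
  have h₂ := hfin.isAbelianSubcategory_isFinPres_quot
  have h₃ := CatIdeal.inducesExtIsos_pushforwardFinPres _ hproj hzero hfin.isFinPres_pushforward
  exact ⟨CatIdeal.isStronglyIdempotent_of_projective _ hproj hzero, h₁, h₂,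
    hfin.isFinPres_pushforward, h₃, h₃.full_mapBoundedDerivedCategory,
    h₃.faithful_mapBoundedDerivedCategory⟩
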